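/- Let the torus $T^k=(S^1)^k$ act continuously and orthogonally (not necessarily faithfully) on $\mathbb{R}^m$. Stratify $\mathbb{R}^m$ by isotropy group ($T^k$ is abelian, so conjugate isotropy groups are equal), and $\mathbb{R}^m/T^k$ by the images of these strata. Each stratum of $\mathbb{R}^m/T^k$ carries the quotient Riemannian metric, i.e. the one for which the orbit projection from the corresponding stratum of $\mathbb{R}^m$ is a Riemannian submersion. The curvature at a point $p\in\mathbb{R}^m/T^k$ is *stratified bounded* if there are $C>0$ and a neighborhood $W$ of $p$ such that, for every stratum $S$, all sectional curvatures of $S$ at points of $S\cap W$ are at most $C$ in absolute value. The quotient $\mathbb{R}^m/T^k$ has *bounded stratified curvature* if its curvature is stratified bounded at each of its points; it has *uniformly* bounded stratified curvature if one constant $C$ bounds the absolute values of the sectional curvatures of all strata on the whole of $\mathbb{R}^m/T^k$. The action is *split* if for every two-dimensional linear subspace $V\subseteq\mathbb{R}^m$ that is $T^k$-invariant but not pointwise fixed by $T^k$, there is a circle subgroup $S^1\le T^k$ that rotates $V$ (acting transitively on the circles of $V$ centred at $0$) and fixes the orthogonal complement $V^\perp$ pointwise. Then $\mathbb{R}^m/T^k$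 has bounded stratified curvature if and only if the action is split. Likewise, $\mathbb{R}^m/T^k$ has uniformly bounded stratified curvature if and only if the action is split. -/

import Mathlib

open scoped ContDiff Topology

noncomputable section

namespace ToricQuotient

/-- The torus `T^k = S¹ × ⋯ × S¹`. -/
abbrev Torus (k : ℕ) : Type := Fin k → Circle

/-- Euclidean `n`-space. -/
abbrev Euc (n : ℕ) : Type := EuclideanSpace ℝ (Fin n)

/-- The orthogonal group of Euclidean `m`-space, as linear isometries (a group under composition). -/
abbrev Orth (m : ℕ) : Type := Euc m ≃ₗᵢ[ℝ] Euc m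

variable {k m : ℕ}

/-! ### The orbit space and its stratification -/

/-- Two points are equivalent when they lie on the same orbit. -/
def orbitSetoid (ρ : Torus k →* Orth m) : Setoid (Euc m) where
  r x y := ∃ t, ρ t x = y
  iseqv :=
    { refl := fun x => ⟨1, by simp⟩
      symm := by
        rintro x y ⟨t, rfl⟩
        exact ⟨t⁻¹, by rw [map_inv]; exact (ρ t).symm_apply_apply x⟩
      trans := by
        rintro x y z ⟨t, rfl⟩ ⟨s, rfl⟩
        exact ⟨s * t, by simp⟩ }

/-- The quotient `ℝ^m / T^k`, with the quotient topology. -/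
abbrev OrbitSpace (ρ : Torus k →* Orth m) : Type := Quotient (orbitSetoid ρ)

/-- The orbit projection `ℝ^m → ℝ^m / T^k`. -/
def orbitMap (ρ : Torus k →* Orth m) (x : Euc m) : OrbitSpace ρ :=
  Quotient.mk (orbitSetoid ρ) x

/-- The isotropy group of `x`. -/
def isotropy (ρ : Torus k →* Orth m) (x : Euc m) : Subgroup (Torus k) where
  carrier := {t | ρ t x = x}
  one_mem' := by simp
  mul_mem' := by
    intro s t (hs : ρ s x = x) (ht : ρ t x = x)
    change ρ (s * t) x = x
    rw [map_mul]
    change ρ s (ρ t x) = x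
    rw [ht, hs]
  inv_mem' := by
    intro t (ht : ρ t x = x)
    change ρ t⁻¹ x = x
    rw [map_inv]
    exact (ρ t).symm_apply_eq.mpr ht.symm

/-- The stratum of `ℝ^m` of isotropy type `H`. As the torus is abelian, two isotropy groups are
conjugate if and only if they are equal. The strata of `ℝ^m / T^k` are the images of these sets. -/
def stratum (ρ : Torus k →* Orth m) (H : Subgroup (Torus k)) : Set (Euc m) :=
  {x | isotropy ρ x = H}

/-- The linear subspace fixed by `H`. The stratum of isotropy type `H` is an open subset of it, so
this is the tangent space of that stratum at each of its points. -/
def fixedSpace (ρ : Torus k →* Orth m) (H : Subgroup (Torus k)) : Submodule ℝ (Euc m) where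
  carrier := {v | ∀ h ∈ H, ρ h v = v}
  zero_mem' := by simp
  add_mem' := by
    intro a b ha hb h hh
    rw [map_add, ha h hh, hb h hh]
  smul_mem' := by
    intro c a ha h hh
    rw [map_smul, ha h hh]

/-! ### The quotient Riemannian metric -/

/-- The exponential map `ℝ^k → T^k` of the torus. -/
def torusExp (ξ : Fin k → ℝ) : Torus k := fun i => Circle.exp (ξ i)

/-- The vertical space at `x`: the tangent space of the orbit through `x`, spanned by the values at
`x` of the Killing fields of the action. -/
def verticalSpace (ρ : Torus k →* Orth m) (x : Euc m) : Submodule ℝ (Euc m) :=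
  Submodule.span ℝ
    {v | ∃ ξ : Fin k → ℝ, HasDerivAt (fun r : ℝ => ρ (torusExp (r • ξ)) x) v 0}

/-- The orthogonal projection onto the horizontal space at `x`, the orthogonal complement of the
vertical space. -/
def horizontalProj (ρ : Torus k →* Orth m) (x : Euc m) : Euc m →L[ℝ] Euc m :=
  (verticalSpace ρ x)ᗮ.starProjection

/-- Smooth local coordinates on the stratum of `ℝ^m / T^k` of isotropy type `H`, given by a lift `s`
to `ℝ^m`: the map `s` is smooth on the open set `U ⊆ ℝ^d`, takes values in the stratum, is an
immersion, and is transverse to the orbits in the stratum with tangent spaces of complementary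
dimension. Equivalently, the composition of `s` with the orbit projection is a local diffeomorphism
from `U` to the quotient stratum. -/
structure IsLocalCoordinates (ρ : Torus k →* Orth m) (H : Subgroup (Torus k)) {d : ℕ}
    (U : Set (Euc d)) (s : Euc d → Euc m) : Prop where
  isOpen : IsOpen U
  smooth : ContDiffOn ℝ ∞ s U
  mapsTo : Set.MapsTo s U (stratum ρ H)
  immersion : ∀ u ∈ U, Function.Injective (fderiv ℝ s u)
  disjoint : ∀ u ∈ U,
    Disjoint (LinearMap.range (fderiv ℝ s u).toLinearMap) (verticalSpace ρ (s u))
  span : ∀ u ∈ U,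
    LinearMap.range (fderiv ℝ s u).toLinearMap ⊔ verticalSpace ρ (s u) = fixedSpace ρ H

/-- The `i`-th standard basis vector of `ℝ^d`. -/
def basisVec {d : ℕ} (i : Fin d) : Euc d := EuclideanSpace.single i 1

/-- The quotient Riemannian metric in the local coordinates given by `s`: the metric on the quotient
stratum for which the orbit projection is a Riemannian submersion assigns to the coordinate fields
`∂_i`, `∂_j` the inner product of the horizontal parts of their lifts `∂_i s`, `∂_j s`. -/
def quotientMetric (ρ : Torus k →* Orth m) {d : ℕ} (s : Euc d → Euc m) (u : Euc d) :
    Matrix (Fin d) (Fin d) ℝ :=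
  Matrix.of fun i j =>
    inner ℝ (horizontalProj ρ (s u) (fderiv ℝ s u (basisVec i)))
      (horizontalProj ρ (s u) (fderiv ℝ s u (basisVec j)))

/-! ### Curvature of a Riemannian metric in coordinates -/

section Curvature

variable {d : ℕ}

/-- The partial derivative `∂_i f` at `u`. -/
def pderiv (i : Fin d) (f : Euc d → ℝ) (u : Euc d) : ℝ := fderiv ℝ f u (basisVec i)

/-- The Christoffel symbol `Γ^p_{ij}` of the metric `g`. -/
def christoffel (g : Euc d → Matrix (Fin d) (Fin d) ℝ) (p i j : Fin d) (u : Euc d) : ℝ :=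
  (1 / 2 : ℝ) * ∑ l, (g u)⁻¹ p l *
    (pderiv i (fun x => g x j l) u + pderiv j (fun x => g x i l) u
      - pderiv l (fun x => g x i j) u)

/-- The coefficient `R_{ijkl} = ⟨R(∂_i, ∂_j) ∂_k, ∂_l⟩` of the Riemann curvature tensor, with
`R(X, Y) = ∇_X ∇_Y - ∇_Y ∇_X - ∇_{[X, Y]}`. -/
def riemannTensor (g : Euc d → Matrix (Fin d) (Fin d) ℝ) (i j k l : Fin d) (u : Euc d) : ℝ :=
  ∑ p, g u p l *
    (pderiv i (christoffel g p j k) u - pderiv j (christoffel g p i k) u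
      + ∑ q, (christoffel g p i q u * christoffel g q j k u
        - christoffel g p j q u * christoffel g q i k u))

/-- The inner product `g_u(a, b)`. -/
def metricInner (g : Euc d → Matrix (Fin d) (Fin d) ℝ) (u a b : Euc d) : ℝ :=
  ∑ i, ∑ j, g u i j * a i * b j

/-- The number `⟨R(a, b) b, a⟩` at `u`. -/
def curvatureForm (g : Euc d → Matrix (Fin d) (Fin d) ℝ) (u a b : Euc d) : ℝ :=
  ∑ i, ∑ j, ∑ k, ∑ l, riemannTensor g i j k l u * a i * b j * b k * a l

/-- All sectional curvatures `⟨R(a, b) b, a⟩ / (|a|² |b|² - ⟨a, b⟩²)` of `g` at `u` have absolute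
value at most `C`. -/
def SectionalCurvatureBoundedAt (g : Euc d → Matrix (Fin d) (Fin d) ℝ) (u : Euc d) (C : ℝ) : Prop :=
  ∀ a b : Euc d, |curvatureForm g u a b| ≤
    C * (metricInner g u a a * metricInner g u b b - metricInner g u a b ^ 2)

end Curvature

/-! ### Bounded stratified curvature and split actions -/

/-- On the part `W` of the orbit space, the curvature of every stratum is bounded by `C`. -/
def StratifiedCurvatureBoundedOn (ρ : Torus k →* Orth m) (W : Set (OrbitSpace ρ)) (C : ℝ) : Prop :=
  ∀ (H : Subgroup (Torus k)) (d : ℕ) (U : Set (Euc d)) (s : Euc d → Euc m),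
    IsLocalCoordinates ρ H U s →
      ∀ u ∈ U, orbitMap ρ (s u) ∈ W → SectionalCurvatureBoundedAt (quotientMetric ρ s) u C

/-- The curvature at the point `p` of the orbit space is stratified bounded. -/
def CurvatureStratifiedBoundedAt (ρ : Torus k →* Orth m) (p : OrbitSpace ρ) : Prop :=
  ∃ C : ℝ, 0 < C ∧ ∃ W ∈ 𝓝 p, StratifiedCurvatureBoundedOn ρ W C

/-- The orbit space has bounded stratified curvature: the curvature is stratified bounded at each
of its points. -/
def HasBoundedStratifiedCurvature (ρ : Torus k →* Orth m) : Prop :=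
  ∀ p : OrbitSpace ρ, CurvatureStratifiedBoundedAt ρ p

/-- The orbit space has bounded stratified curvature, with one bound for the whole space. -/
def HasUniformlyBoundedStratifiedCurvature (ρ : Torus k →* Orth m) : Prop :=
  ∃ C : ℝ, 0 < C ∧ StratifiedCurvatureBoundedOn ρ Set.univ C

/-- The action is split: for every invariant plane `V` that is not pointwise fixed there is a circle
subgroup of the torus (the image of an injective continuous homomorphism `c` from the circle) that
rotates `V`, carrying any vector of `V` to any other of the same length, and fixes the orthogonal
complement of `V` pointwise. -/
def IsSplit (ρ : Torus k →* Orth m) : Prop :=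
  ∀ V : Submodule ℝ (Euc m), Module.finrank ℝ V = 2 →
    (∀ t, ∀ v ∈ V, ρ t v ∈ V) → ¬ (∀ t, ∀ v ∈ V, ρ t v = v) →
      ∃ c : Circle →* Torus k, Continuous c ∧ Function.Injective c ∧
        (∀ v ∈ V, ∀ w ∈ V, ‖v‖ = ‖w‖ → ∃ z, ρ (c z) v = w) ∧
        (∀ z, ∀ w ∈ Vᗮ, ρ (c z) w = w)

end ToricQuotient

end

/-! Under the torus, ℝ^m splits orthogonally into a pointwise fixed subspace and planes P_i =
span(e_i, f_i), on which the torus acts by rotation with weights w_i ≠ 0 in ℤ^k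
(`exists_isWeightBasis`). Being split and having bounded stratified curvature are both equivalent to
linear independence of the weights, in the form `HasDualCoweights`: for each i some integral
coweight is nonzero on w_i and zero on every other weight.

Independence and splitting. A dual coweight, made primitive, is a circle subgroup that rotates P_i
alone, and under independence the P_i are the only invariant planes that are not fixed. Conversely,
given a relation ∑ c_j w_j = 0 with c_i ≠ 0, a circle that moves only P_i cannot turn it through the
angle π / c_i: the relation would make an odd multiple of π vanish.

Independence gives flatness. The orbits are then products of circles, one in each plane where the
point has a nonzero component. On a stratum the quotient is described by the fixed part and the
nonzero radii, and these are Euclidean coordinates for the quotient metric. Technically, `radialMap`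
composed with a local lift is an immersion with constant tangent space that induces the quotient
metric, so its curvature vanishes (`riemannTensor_eq_zero_of_constant_range`).

Dependence gives unbounded curvature near the origin. At x₀ = r ∑ e_j the vectors e_i and b = ∑ c_j
f_j are horizontal. In an affine horizontal slice through x₀ the curvature is O'Neill's term, 3 ∑_a
⟨K_a e_i, b⟩², where the Killing fields K_a are orthonormal at x₀ (`curvatureForm_slice`). Killing
fields are linear, so K_a must grow like 1/r as r → 0, and the curvature like 1/r²
(`le_of_stratifiedCurvatureBoundedOn`).

Bounded curvature thus gives independence, hence splitting; splitting gives independence, hence the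
uniform bound, which contains the pointwise one. -/

noncomputable section

namespace ToricQuotient

/-! ### One-parameter groups of operators -/

section OneParameter

variable {E : Type*} [NormedAddCommGroup E] [InnerProductSpace ℝ E]

/-- A generator of a one-parameter group of isometries is skew-adjoint. -/
theorem inner_generator_left {φ : ℝ → E →ₗ[ℝ] E} (hzero : ∀ x, φ 0 x = x)
    (hiso : ∀ t x y, inner ℝ (φ t x) (φ t y) = inner ℝ x y) {A : E →ₗ[ℝ] E}
    (hA : ∀ x t, HasDerivAt (fun t => φ t x) (φ t (A x)) t) (x y : E) :
    inner ℝ (A x) y = -inner ℝ x (A y) := by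
  have h := (hA x 0).inner ℝ (hA y 0)
  simp only [hiso, hzero] at h
  have := h.unique (hasDerivAt_const (0 : ℝ) (inner ℝ x y))
  linarith

/-- A one-parameter group rotates a plane on which its generator is a multiple of a rotation by a
right angle. -/
theorem oneParameter_apply_eq_rotation {φ : ℝ → E →ₗ[ℝ] E}
    (hadd : ∀ s t x, φ (s + t) x = φ s (φ t x)) (hzero : ∀ x, φ 0 x = x) {A : E →ₗ[ℝ] E}
    (hA : ∀ x t, HasDerivAt (fun t => φ t x) (φ t (A x)) t) {e f : E} {c : ℝ}
    (he : A e = c • f) (hf : A f = -c • e) (t : ℝ) :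
    φ t e = Real.cos (c * t) • e + Real.sin (c * t) • f := by
  -- Undoing the flow on the claimed value of φ t e gives a curve with derivative zero, so it stays
  -- at its initial value e.
  have hconst : ∀ t, HasDerivAt
      (fun t => Real.cos (c * t) • φ (-t) e + Real.sin (c * t) • φ (-t) f) 0 t := by
    intro t
    have h1 : ∀ x, HasDerivAt (fun t => φ (-t) x) (-φ (-t) (A x)) t := fun x => by
      simpa [Function.comp_def] using (hA x (-t)).scomp t (hasDerivAt_neg t)
    have hc : HasDerivAt (fun t => c * t) c t := by simpa using (hasDerivAt_id t).const_mul c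
    convert (hc.cos.fun_smul (h1 e)).fun_add (hc.sin.fun_smul (h1 f)) using 1
    rw [he, hf]
    simp only [map_smul]
    module
  have h := is_const_of_deriv_eq_zero (fun t => (hconst t).differentiableAt)
    (fun t => (hconst t).deriv) t 0
  simp only [neg_zero, mul_zero, Real.cos_zero, Real.sin_zero, one_smul, zero_smul, add_zero,
    hzero] at h
  conv_lhs => rw [← h]
  simp only [map_add, map_smul, ← hadd, add_neg_cancel, hzero]

variable [FiniteDimensional ℝ E]

/-- The orbits of a continuous one-parameter group of operators of a finite-dimensional space are
differentiable. -/
theorem exists_hasDerivAt_zero_of_oneParameter (φ : ℝ → E →ₗ[ℝ] E)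
    (hadd : ∀ s t x, φ (s + t) x = φ s (φ t x)) (hzero : ∀ x, φ 0 x = x)
    (hcont : ∀ x, Continuous fun t => φ t x) (x : E) :
    ∃ y, HasDerivAt (fun t => φ t x) y 0 := by
  -- The vectors with differentiable orbit form a subspace, closed because the dimension is finite.
  -- The averages of an orbit over [0, a] lie in it and tend to x as a → 0.
  let S : Submodule ℝ E :=
    { carrier := {x | ∃ y, HasDerivAt (fun t => φ t x) y 0}
      zero_mem' := ⟨0, by simpa using hasDerivAt_const (0 : ℝ) (0 : E)⟩
      add_mem' := by
        rintro a b ⟨y, hy⟩ ⟨z, hz⟩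
        exact ⟨y + z, by simpa using hy.fun_add hz⟩
      smul_mem' := by
        rintro c a ⟨y, hy⟩
        exact ⟨c • y, by simpa using hy.fun_const_smul c⟩ }
  have hint : ∀ a b, IntervalIntegrable (fun s => φ s x) MeasureTheory.volume a b :=
    fun a b => (hcont x).intervalIntegrable a b
  have hder : ∀ a, HasDerivAt (fun t => ∫ s in (0 : ℝ)..t, φ s x) (φ a x) a := fun a =>
    intervalIntegral.integral_hasDerivAt_right (hint _ _)
      ((hcont x).stronglyMeasurableAtFilter _ _) (hcont x).continuousAt
  have hmem : ∀ a : ℝ, (∫ s in (0 : ℝ)..a, φ s x) ∈ S := by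
    intro a
    refine ⟨φ a x - φ 0 x, ?_⟩
    have h1 : ∀ t, φ t (∫ s in (0 : ℝ)..a, φ s x) =
        (∫ s in (0 : ℝ)..(t + a), φ s x) - ∫ s in (0 : ℝ)..t, φ s x := by
      intro t
      have h2 : φ t (∫ s in (0 : ℝ)..a, φ s x) = ∫ s in (0 : ℝ)..a, φ (t + s) x := by
        have := (LinearMap.toContinuousLinearMap (φ t)).intervalIntegral_comp_comm (hint 0 a)
        simp only [LinearMap.coe_toContinuousLinearMap'] at this
        rw [← this]
        simp only [hadd]
      rw [h2, intervalIntegral.integral_comp_add_left (fun s => φ s x) t,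
        intervalIntegral.integral_interval_sub_left (hint _ _) (hint _ _), add_zero]
    simp only [h1]
    refine HasDerivAt.sub ?_ (hder 0)
    have := (hder (0 + a)).comp_add_const 0 a
    simpa using this
  have hlim : Filter.Tendsto (fun a : ℝ => a⁻¹ • ∫ s in (0 : ℝ)..a, φ s x) (𝓝[≠] 0) (𝓝 x) := by
    have := (hder 0).tendsto_slope_zero
    simpa [hzero] using this
  have hclosed : IsClosed (S : Set E) := S.closed_of_finiteDimensional
  exact hclosed.mem_of_tendsto hlim (Filter.Eventually.of_forall fun a => S.smul_mem _ (hmem a))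

/-- A continuous one-parameter group of operators has an infinitesimal generator. -/
theorem exists_generator (φ : ℝ → E →ₗ[ℝ] E)
    (hadd : ∀ s t x, φ (s + t) x = φ s (φ t x)) (hzero : ∀ x, φ 0 x = x)
    (hcont : ∀ x, Continuous fun t => φ t x) :
    ∃ A : E →ₗ[ℝ] E, ∀ x t, HasDerivAt (fun t => φ t x) (φ t (A x)) t := by
  choose A hA using exists_hasDerivAt_zero_of_oneParameter φ hadd hzero hcont
  refine ⟨⟨⟨A, fun x y => ?_⟩, fun c x => ?_⟩, fun x t => ?_⟩
  · refine (hA (x + y)).unique ?_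
    simpa using (hA x).fun_add (hA y)
  · refine (hA (c • x)).unique ?_
    simpa using (hA x).fun_const_smul c
  · have h := (LinearMap.toContinuousLinearMap (φ t)).hasFDerivAt.comp_hasDerivAt (0 : ℝ) (hA x)
    have h' : HasDerivAt (fun r => φ (t + r) x) (φ t (A x)) 0 := by
      simpa [Function.comp_def, hadd] using h
    have h2 : HasDerivAt (fun r => φ (t + r) x) (φ t (A x)) (-t + t) := by simpa using h'
    have := h2.comp_const_add (-t) t
    simpa using this

/-- Generators of commuting one-parameter groups commute. -/
theorem generator_comm {φ ψ : ℝ → E →ₗ[ℝ] E} (hφ : ∀ x, φ 0 x = x) (hψ : ∀ x, ψ 0 x = x)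
    (hcomm : ∀ s t x, φ s (ψ t x) = ψ t (φ s x)) {A B : E →ₗ[ℝ] E}
    (hA : ∀ x t, HasDerivAt (fun t => φ t x) (φ t (A x)) t)
    (hB : ∀ x t, HasDerivAt (fun t => ψ t x) (ψ t (B x)) t) (x : E) :
    A (B x) = B (A x) := by
  -- Differentiating the commutation relation in one parameter at 0 makes A commute with ψ;
  -- differentiating in the other gives the claim.
  have h1 : ∀ t, A (ψ t x) = ψ t (A x) := by
    intro t
    have h2 := (LinearMap.toContinuousLinearMap (ψ t)).hasFDerivAt.comp_hasDerivAt (0 : ℝ) (hA x 0)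
    have h3 := hA (ψ t x) 0
    simp only [hφ, hcomm] at h3 h2
    exact h3.unique h2
  have h2 := (LinearMap.toContinuousLinearMap A).hasFDerivAt.comp_hasDerivAt (0 : ℝ) (hB x 0)
  have h3 := hB (A x) 0
  simp only [hψ, Function.comp_def, LinearMap.coe_toContinuousLinearMap', h1] at h3 h2
  exact h2.unique h3

end OneParameter

/-! ### Commuting skew-adjoint operators -/

section Skew

variable {E : Type*} [NormedAddCommGroup E] [InnerProductSpace ℝ E] [FiniteDimensional ℝ E]
  {κ : Type*} {A : κ → E →ₗ[ℝ] E}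

/-- A nonzero invariant subspace of a commuting family of symmetric operators contains a joint
eigenvector. -/
theorem exists_joint_eigenvector {T : κ → E →ₗ[ℝ] E} (hT : ∀ i, (T i).IsSymmetric)
    (hcomm : ∀ i j x, T i (T j x) = T j (T i x)) {W : Submodule ℝ E}
    (hW : ∀ i, ∀ x ∈ W, T i x ∈ W) (hne : W ≠ ⊥) :
    ∃ v ∈ W, v ≠ 0 ∧ ∃ c : κ → ℝ, ∀ i, T i v = c i • v := by
  have hsym : ∀ i, ((T i).restrict (hW i)).IsSymmetric := fun i => (hT i).restrict_invariant (hW i)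
  have htop := LinearMap.IsSymmetric.iSup_iInf_eq_top_of_commute
    (T := fun i => (T i).restrict (hW i)) hsym (by
      intro i j _
      ext x
      simp [hcomm i j])
  by_contra hcon
  push Not at hcon
  have hbot : ∀ c : κ → ℝ, (⨅ i, Module.End.eigenspace ((T i).restrict (hW i)) (c i)) = ⊥ := by
    intro c
    rw [eq_bot_iff]
    intro x hx
    rw [Submodule.mem_iInf] at hx
    by_contra hx0
    obtain ⟨i, hi⟩ := hcon x.1 x.2 (by simpa using hx0) c
    apply hi
    have := Module.End.mem_eigenspace_iff.mp (hx i)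
    simpa using congrArg Subtype.val this
  simp only [hbot, iSup_bot] at htop
  apply hne
  rw [eq_bot_iff]
  intro x hx
  have : (⟨x, hx⟩ : W) ∈ (⊥ : Submodule ℝ W) := by rw [htop]; trivial
  simpa using this

/-- A commuting family of skew-adjoint operators rotates a plane in any nonzero invariant
subspace without joint kernel. -/
theorem exists_rotated_plane (hskew : ∀ i x y, inner ℝ (A i x) y = -inner ℝ x (A i y))
    (hcomm : ∀ i j x, A i (A j x) = A j (A i x)) {W : Submodule ℝ E}
    (hW : ∀ i, ∀ x ∈ W, A i x ∈ W) (hne : W ≠ ⊥) (hker : ∀ x ∈ W, (∀ i, A i x = 0) → x = 0) :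
    ∃ e ∈ W, ∃ f ∈ W, ∃ c : κ → ℝ, ‖e‖ = 1 ∧ ‖f‖ = 1 ∧ inner ℝ e f = 0 ∧ c ≠ 0 ∧
      ∀ i, A i e = c i • f ∧ A i f = -c i • e := by
  -- The products of two commuting skew operators are symmetric and commute, so they have a joint
  -- eigenvector v in W.
  obtain ⟨v, hvW, hv0, c, hc⟩ := exists_joint_eigenvector
    (T := fun p : κ × κ => A p.1 ∘ₗ A p.2)
    (fun p x y => by
      simp only [LinearMap.comp_apply, hskew, neg_neg]
      rw [hcomm])
    (fun p q x => by
      simp only [LinearMap.comp_apply]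
      rw [hcomm p.2 q.1, hcomm p.1 q.1, hcomm p.2 q.2, hcomm p.1 q.2])
    (W := W) (fun p x hx => hW _ _ (hW _ _ hx)) hne
  simp only [LinearMap.comp_apply, Prod.forall] at hc
  obtain ⟨i, hi⟩ : ∃ i, A i v ≠ 0 := by
    by_contra! h
    exact hv0 (hker v hvW h)
  have hvn : 0 < ‖v‖ := norm_pos_iff.mpr hv0
  have hAn : 0 < ‖A i v‖ := norm_pos_iff.mpr hi
  have hsq : ‖A i v‖ ^ 2 = -c (i, i) * ‖v‖ ^ 2 := by
    rw [← real_inner_self_eq_norm_sq, hskew, hc i i, inner_smul_right, real_inner_self_eq_norm_sq]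
    ring
  have hcne : c (i, i) ≠ 0 := by
    intro h
    rw [h] at hsq
    simp only [neg_zero, zero_mul] at hsq
    exact hAn.ne' (by simpa using hsq)
  -- Evaluating A_j A_i A_i v in two ways shows that all A_j v are multiples of the single vector
  -- A_i v. So v and A_i v span an invariant plane; the final coefficients account for normalizing
  -- the two vectors.
  have hAj : ∀ j, c (i, i) • A j v = c (i, j) • A i v := by
    intro j
    rw [← map_smul, ← hc i i, hcomm j i, hcomm j i, hc i j, map_smul]
  have hAj' : ∀ j, A j v = (c (i, j) / c (i, i)) • A i v := by
    intro j
    rw [div_eq_inv_mul, mul_smul, ← hAj j, smul_smul, inv_mul_cancel₀ hcne, one_smul]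
  have hAi : A i (A i v) = -(‖A i v‖ ^ 2 / ‖v‖ ^ 2) • v := by
    rw [hc i i, hsq]
    congr 1
    field_simp
  refine ⟨‖v‖⁻¹ • v, W.smul_mem _ hvW, ‖A i v‖⁻¹ • A i v, W.smul_mem _ (hW _ _ hvW),
    fun j => c (i, j) / c (i, i) * (‖A i v‖ / ‖v‖), ?_, ?_, ?_, ?_, fun j => ⟨?_, ?_⟩⟩
  · rw [norm_smul, norm_inv, norm_norm, inv_mul_cancel₀ hvn.ne']
  · rw [norm_smul, norm_inv, norm_norm, inv_mul_cancel₀ hAn.ne']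
  · have h := hskew i v v
    rw [real_inner_comm] at h
    have h0 : inner ℝ v (A i v) = 0 := by linarith
    rw [inner_smul_left, inner_smul_right, h0]
    simp
  · intro h
    have := congrFun h i
    simp only [Pi.zero_apply, div_self hcne, one_mul] at this
    exact (div_pos hAn hvn).ne' this
  · rw [map_smul, hAj' j, smul_smul, smul_smul]
    congr 1
    field_simp
  · rw [map_smul, hcomm j i, hAj' j, map_smul, hAi, smul_smul, smul_smul, smul_smul]
    congr 1
    field_simp

/-- A commuting family of skew-adjoint operators rotates an orthogonal family of planes and
vanishes on their common orthogonal complement. -/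
theorem exists_rotated_planes (hskew : ∀ i x y, inner ℝ (A i x) y = -inner ℝ x (A i y))
    (hcomm : ∀ i j x, A i (A j x) = A j (A i x)) :
    ∃ (n : ℕ) (e f : Fin n → E) (c : Fin n → κ → ℝ), Orthonormal ℝ e ∧ Orthonormal ℝ f ∧
      (∀ p q, inner ℝ (e p) (f q) = 0) ∧ (∀ p, c p ≠ 0) ∧
      (∀ p i, A i (e p) = c p i • f p ∧ A i (f p) = -c p i • e p) ∧
      ∀ v, (∀ p, inner ℝ (e p) v = 0) → (∀ p, inner ℝ (f p) v = 0) → ∀ i, A i v = 0 := by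
  classical
  -- Choose a family of planes of maximal size; the dimension bounds the size.
  let P : ℕ → Prop := fun n => ∃ (e f : Fin n → E) (c : Fin n → κ → ℝ), Orthonormal ℝ e ∧
    Orthonormal ℝ f ∧ (∀ p q, inner ℝ (e p) (f q) = 0) ∧ (∀ p, c p ≠ 0) ∧
    (∀ p i, A i (e p) = c p i • f p ∧ A i (f p) = -c p i • e p)
  have hP0 : P 0 := by
    refine ⟨Fin.elim0, Fin.elim0, Fin.elim0, ⟨fun p => p.elim0, fun p => p.elim0⟩,
      ⟨fun p => p.elim0, fun p => p.elim0⟩, fun p => p.elim0, fun p => p.elim0, fun p => p.elim0⟩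
  have hbound : ∀ n, P n → n ≤ Module.finrank ℝ E := by
    rintro n ⟨e, _, _, he, _⟩
    simpa using he.linearIndependent.fintype_card_le_finrank
  obtain ⟨n, hn, hmax⟩ : ∃ n, P n ∧ ¬ P (n + 1) := by
    by_contra! h
    have hall : ∀ n, P n := fun n => Nat.rec hP0 h n
    exact absurd (hbound _ (hall (Module.finrank ℝ E + 1))) (by omega)
  obtain ⟨e, f, c, he, hf, hef, hc, hA⟩ := hn
  refine ⟨n, e, f, c, he, hf, hef, hc, hA, ?_⟩
  let K : Submodule ℝ E := ⨅ i, LinearMap.ker (A i)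
  have hK : ∀ x, x ∈ K ↔ ∀ i, A i x = 0 := by
    intro x
    simp [K, Submodule.mem_iInf]
  have heK : ∀ p, ∀ x ∈ K, inner ℝ (e p) x = 0 ∧ inner ℝ (f p) x = 0 := by
    intro p x hx
    obtain ⟨i, hi⟩ : ∃ i, c p i ≠ 0 := by
      by_contra! h
      exact hc p (funext h)
    have h1 := hskew i (e p) x
    have h2 := hskew i (f p) x
    rw [(hA p i).1, (hK x).1 hx i, inner_smul_left, inner_zero_right] at h1
    rw [(hA p i).2, (hK x).1 hx i, inner_smul_left, inner_zero_right] at h2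
    constructor
    · simpa [hi] using h2
    · simpa [hi] using h1
  -- W is orthogonal to the joint kernel K and to the planes found so far. It is invariant and meets
  -- K only in 0, so if it were nonzero it would contain a further rotated plane, against
  -- maximality.
  let W : Submodule ℝ E := Kᗮ ⊓ (Submodule.span ℝ (Set.range e) ⊔ Submodule.span ℝ (Set.range f))ᗮ
  have hWmem : ∀ x, x ∈ W ↔ x ∈ Kᗮ ∧ (∀ p, inner ℝ (e p) x = 0) ∧ ∀ p, inner ℝ (f p) x = 0 := by
    intro x
    simp only [W, Submodule.mem_inf, ← Submodule.inf_orthogonal]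
    refine and_congr_right fun _ => and_congr ?_ ?_
    · rw [Submodule.mem_orthogonal]
      refine ⟨fun h p => h _ (Submodule.subset_span ⟨p, rfl⟩), fun h u hu => ?_⟩
      induction hu using Submodule.span_induction with
      | mem x hx => obtain ⟨p, rfl⟩ := hx; exact h p
      | zero => simp
      | add a b _ _ ha hb => rw [inner_add_left, ha, hb, add_zero]
      | smul r a _ ha => rw [inner_smul_left, ha, mul_zero]
    · rw [Submodule.mem_orthogonal]
      refine ⟨fun h p => h _ (Submodule.subset_span ⟨p, rfl⟩), fun h u hu => ?_⟩
      induction hu using Submodule.span_induction with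
      | mem x hx => obtain ⟨p, rfl⟩ := hx; exact h p
      | zero => simp
      | add a b _ _ ha hb => rw [inner_add_left, ha, hb, add_zero]
      | smul r a _ ha => rw [inner_smul_left, ha, mul_zero]
  have hskew' : ∀ i x y, inner ℝ x (A i y) = -inner ℝ (A i x) y := fun i x y => by
    rw [hskew, neg_neg]
  have hWinv : ∀ i, ∀ x ∈ W, A i x ∈ W := by
    intro i x hx
    rw [hWmem] at hx ⊢
    refine ⟨?_, fun p => ?_, fun p => ?_⟩
    · rw [Submodule.mem_orthogonal]
      intro u hu
      rw [hskew', (hK u).1 hu i, inner_zero_left, neg_zero]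
    · rw [hskew', (hA p i).1, inner_smul_left, hx.2.2 p, mul_zero, neg_zero]
    · rw [hskew', (hA p i).2, inner_smul_left, hx.2.1 p, mul_zero, neg_zero]
  have hWbot : W = ⊥ := by
    by_contra hne
    obtain ⟨e', he', f', hf', c', hen, hfn, hef', hc', hA'⟩ :=
      exists_rotated_plane hskew hcomm hWinv hne (fun x hx h => by
        have h1 := ((hWmem x).1 hx).1
        have h2 := (hK x).2 h
        exact inner_self_eq_zero.mp (Submodule.inner_right_of_mem_orthogonal h2 h1))
    rw [hWmem] at he' hf'
    apply hmax
    refine ⟨Fin.cons e' e, Fin.cons f' f, Fin.cons c' c, ?_, ?_, ?_, ?_, ?_⟩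
    · refine ⟨fun p => ?_, fun p q hpq => ?_⟩
      · refine Fin.cases ?_ (fun p => ?_) p
        · simpa using hen
        · simpa using he.1 p
      · revert hpq
        refine Fin.cases ?_ (fun p => ?_) p <;> refine Fin.cases ?_ (fun q => ?_) q
        · simp
        · intro _
          simp only [Fin.cons_zero, Fin.cons_succ]
          rw [real_inner_comm, he'.2.1]
        · intro _
          simp only [Fin.cons_zero, Fin.cons_succ]
          rw [he'.2.1]
        · intro h
          simp only [Fin.cons_succ]
          exact he.2 (by simpa using h)
    · refine ⟨fun p => ?_, fun p q hpq => ?_⟩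
      · refine Fin.cases ?_ (fun p => ?_) p
        · simpa using hfn
        · simpa using hf.1 p
      · revert hpq
        refine Fin.cases ?_ (fun p => ?_) p <;> refine Fin.cases ?_ (fun q => ?_) q
        · simp
        · intro _
          simp only [Fin.cons_zero, Fin.cons_succ]
          rw [real_inner_comm, hf'.2.2]
        · intro _
          simp only [Fin.cons_zero, Fin.cons_succ]
          rw [hf'.2.2]
        · intro h
          simp only [Fin.cons_succ]
          exact hf.2 (by simpa using h)
    · intro p q
      refine Fin.cases ?_ (fun p => ?_) p <;> refine Fin.cases ?_ (fun q => ?_) q <;>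
        simp only [Fin.cons_zero, Fin.cons_succ]
      · exact hef'
      · rw [real_inner_comm, he'.2.2]
      · exact hf'.2.1 p
      · exact hef p q
    · intro p
      refine Fin.cases ?_ (fun p => ?_) p
      · simpa using hc'
      · simpa using hc p
    · intro p i
      refine Fin.cases ?_ (fun p => ?_) p
      · simpa using hA' i
      · simpa using hA p i
  intro v hve hvf
  obtain ⟨y, hy, z, hz, rfl⟩ := K.exists_add_mem_mem_orthogonal v
  have hzW : z ∈ W := by
    rw [hWmem]
    refine ⟨hz, fun p => ?_, fun p => ?_⟩
    · have := hve p
      rwa [inner_add_right, (heK p y hy).1, zero_add] at this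
    · have := hvf p
      rwa [inner_add_right, (heK p y hy).2, zero_add] at this
  rw [hWbot, Submodule.mem_bot] at hzW
  rw [hzW, add_zero]
  exact (hK y).1 hy

end Skew

variable {k m n : ℕ}

theorem apply_mul_apply (ρ : Torus k →* Orth m) (s t : Torus k) (x : Euc m) :
    ρ (s * t) x = ρ s (ρ t x) := by
  rw [map_mul]
  rfl

/-! ### The exponential map of the torus -/

theorem torusExp_add (ξ η : Fin k → ℝ) : torusExp (ξ + η) = torusExp ξ * torusExp η := by
  ext i
  simp [torusExp, Circle.exp_add]

theorem torusExp_zero : torusExp (0 : Fin k → ℝ) = 1 := by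
  ext i
  simp [torusExp]

theorem torusExp_surjective : Function.Surjective (torusExp (k := k)) := fun t =>
  ⟨fun i => Complex.arg (t i), by ext i; simp [torusExp]⟩

theorem continuous_torusExp : Continuous (torusExp (k := k)) :=
  continuous_pi fun i => Circle.exp.continuous.comp (continuous_apply i)

/-! ### Weight bases -/

/-- The value of the integral weight `w` on the Lie algebra element `ξ`. -/
def weightPairing (w : Fin k → ℤ) (ξ : Fin k → ℝ) : ℝ := ∑ a, (w a : ℝ) * ξ a

theorem weightPairing_smul (w : Fin k → ℤ) (r : ℝ) (ξ : Fin k → ℝ) :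
    weightPairing w (r • ξ) = r * weightPairing w ξ := by
  simp only [weightPairing, Finset.mul_sum, Pi.smul_apply, smul_eq_mul]
  exact Finset.sum_congr rfl fun _ _ => by ring

theorem weightPairing_add (w : Fin k → ℤ) (ξ η : Fin k → ℝ) :
    weightPairing w (ξ + η) = weightPairing w ξ + weightPairing w η := by
  simp only [weightPairing, ← Finset.sum_add_distrib, Pi.add_apply, mul_add]

theorem weightPairing_zero (w : Fin k → ℤ) : weightPairing w 0 = 0 := by
  simp [weightPairing]

/-- The vectors `e i`, `f i` form an orthonormal family, the torus rotates the plane of `e i` and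
`f i` with weight `w i ≠ 0`, and it fixes the orthogonal complement of all these planes. -/
structure IsWeightBasis (ρ : Torus k →* Orth m) (e f : Fin n → Euc m) (w : Fin n → Fin k → ℤ) :
    Prop where
  orthonormal_left : Orthonormal ℝ e
  orthonormal_right : Orthonormal ℝ f
  inner_left_right : ∀ i j, inner ℝ (e i) (f j) = 0
  weight_ne_zero : ∀ i, w i ≠ 0
  apply_left : ∀ ξ i, ρ (torusExp ξ) (e i) =
    Real.cos (weightPairing (w i) ξ) • e i + Real.sin (weightPairing (w i) ξ) • f i
  apply_right : ∀ ξ i, ρ (torusExp ξ) (f i) =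
    -Real.sin (weightPairing (w i) ξ) • e i + Real.cos (weightPairing (w i) ξ) • f i
  apply_compl : ∀ v, (∀ i, inner ℝ (e i) v = 0) → (∀ i, inner ℝ (f i) v = 0) → ∀ t, ρ t v = v

/-- A vector ξ is the sum of its coordinate components, and rotations of one plane compose by adding
angles. The degenerate case f = 0, w = 0 covers fixed vectors. -/
theorem rotation_of_coordinates (ρ : Torus k →* Orth m) {e f : Euc m} {w : Fin k → ℤ}
    (he : ∀ a (r : ℝ), ρ (torusExp (r • Pi.single a 1)) e =
      Real.cos (w a * r) • e + Real.sin (w a * r) • f)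
    (hf : ∀ a (r : ℝ), ρ (torusExp (r • Pi.single a 1)) f =
      -Real.sin (w a * r) • e + Real.cos (w a * r) • f) (ξ : Fin k → ℝ) :
    ρ (torusExp ξ) e =
        Real.cos (weightPairing w ξ) • e + Real.sin (weightPairing w ξ) • f ∧
      ρ (torusExp ξ) f =
        -Real.sin (weightPairing w ξ) • e + Real.cos (weightPairing w ξ) • f := by
  have key : ∀ s : Finset (Fin k),
      ρ (torusExp (∑ a ∈ s, ξ a • Pi.single a 1)) e =
          Real.cos (∑ a ∈ s, (w a : ℝ) * ξ a) • e + Real.sin (∑ a ∈ s, (w a : ℝ) * ξ a) • f ∧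
        ρ (torusExp (∑ a ∈ s, ξ a • Pi.single a 1)) f =
          -Real.sin (∑ a ∈ s, (w a : ℝ) * ξ a) • e + Real.cos (∑ a ∈ s, (w a : ℝ) * ξ a) • f := by
    intro s
    induction s using Finset.induction_on with
    | empty => simp [torusExp_zero]
    | insert a s ha ih =>
      rw [Finset.sum_insert ha, Finset.sum_insert ha, torusExp_add]
      simp only [apply_mul_apply, ih.1, ih.2, map_add, map_smul, he, hf,
        Real.cos_add, Real.sin_add]
      constructor <;> module
  have h := key Finset.univ
  have hξ : ∑ a, ξ a • (Pi.single a 1 : Fin k → ℝ) = ξ := by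
    ext b
    simp [Pi.single_apply]
  rw [hξ] at h
  exact h

/-- Every continuous orthogonal representation of a torus has a weight basis. -/
theorem exists_isWeightBasis (ρ : Torus k →* Orth m)
    (hρ : ∀ x : Euc m, Continuous fun t : Torus k => ρ t x) :
    ∃ (n : ℕ) (e f : Fin n → Euc m) (w : Fin n → Fin k → ℤ), IsWeightBasis ρ e f w := by
  let φ : Fin k → ℝ → Euc m →ₗ[ℝ] Euc m := fun a t =>
    (ρ (torusExp (t • Pi.single a 1))).toLinearEquiv.toLinearMap
  have hφ : ∀ a t x, φ a t x = ρ (torusExp (t • Pi.single a 1)) x := fun _ _ _ => rfl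
  have hadd : ∀ a s t x, φ a (s + t) x = φ a s (φ a t x) := by
    intro a s t x
    simp only [hφ, add_smul, torusExp_add, apply_mul_apply]
  have hzero : ∀ a x, φ a 0 x = x := by
    intro a x
    simp [hφ, torusExp_zero]
  have hcomm : ∀ a b s t x, φ a s (φ b t x) = φ b t (φ a s x) := by
    intro a b s t x
    simp only [hφ, ← apply_mul_apply]
    rw [mul_comm]
  have hiso : ∀ a t x y, inner ℝ (φ a t x) (φ a t y) = inner ℝ x y := fun a t x y =>
    (ρ (torusExp (t • Pi.single a 1))).inner_map_map x y
  have hcont : ∀ a x, Continuous fun t => φ a t x := fun a x =>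
    (hρ x).comp (continuous_torusExp.comp (by fun_prop))
  have hperiod : ∀ a x, φ a (2 * Real.pi) x = x := by
    intro a x
    have : torusExp ((2 * Real.pi) • (Pi.single a 1 : Fin k → ℝ)) = 1 := by
      funext b
      by_cases hb : b = a
      · subst hb
        simp [torusExp]
      · simp [torusExp, hb]
    rw [hφ, this, map_one]
    rfl
  choose A hA using fun a => exists_generator (φ a) (hadd a) (hzero a) (hcont a)
  obtain ⟨n, e, f, c, he, hf, hef, hc, hAef, hker⟩ := exists_rotated_planes (A := A)
    (fun a x y => inner_generator_left (hzero a) (hiso a) (hA a) x y)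
    (fun a b x => generator_comm (hzero a) (hzero b) (hcomm a b) (hA a) (hA b) x)
  have hrote : ∀ i a t, φ a t (e i) = Real.cos (c i a * t) • e i + Real.sin (c i a * t) • f i :=
    fun i a t => oneParameter_apply_eq_rotation (hadd a) (hzero a) (hA a) (hAef i a).1
      (hAef i a).2 t
  have hrotf : ∀ i a t, φ a t (f i) = -Real.sin (c i a * t) • e i + Real.cos (c i a * t) • f i := by
    intro i a t
    -- Exchanging the two basis vectors reverses the orientation, hence the sign of the angular
    -- velocity.
    have := oneParameter_apply_eq_rotation (e := f i) (f := e i) (c := -c i a) (hadd a) (hzero a)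
      (hA a) (hAef i a).2 (by rw [(hAef i a).1, neg_neg]) t
    rw [this, neg_mul, Real.cos_neg, Real.sin_neg, add_comm]
  -- Each coordinate circle closes up after time 2π, so cos(2π c) = 1 and the angular velocity c is
  -- an integer.
  have hint : ∀ i a, ∃ z : ℤ, (z : ℝ) = c i a := by
    intro i a
    have h := hrote i a (2 * Real.pi)
    rw [hperiod] at h
    have h1 := congrArg (fun v => inner ℝ (e i) v) h
    simp only [inner_add_right, inner_smul_right, hef, real_inner_self_eq_norm_sq, he.1 i] at h1
    have h2 : Real.cos (c i a * (2 * Real.pi)) = 1 := by linarith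
    obtain ⟨z, hz⟩ := (Real.cos_eq_one_iff _).1 h2
    exact ⟨z, mul_right_cancel₀ Real.two_pi_pos.ne' hz⟩
  choose w hw using hint
  have hrot := fun ξ i => rotation_of_coordinates ρ (e := e i) (f := f i) (w := w i)
    (fun a r => by rw [hw, ← hφ]; exact hrote i a r)
    (fun a r => by rw [hw, ← hφ]; exact hrotf i a r) ξ
  refine ⟨n, e, f, w, he, hf, hef, fun i h => hc i ?_, fun ξ i => (hrot ξ i).1,
    fun ξ i => (hrot ξ i).2, fun v hev hfv t => ?_⟩
  · funext a
    rw [← hw i a, h]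
    simp
  · obtain ⟨ξ, rfl⟩ := torusExp_surjective t
    have hv := hker v hev hfv
    have h1 : ∀ (a : Fin k) (r : ℝ), ρ (torusExp (r • Pi.single a 1)) v = v := by
      intro a r
      have := oneParameter_apply_eq_rotation (e := v) (f := 0) (c := 0) (hadd a) (hzero a)
        (hA a) (by rw [hv a, zero_smul]) (by simp) r
      simpa [hφ] using this
    have := (rotation_of_coordinates ρ (e := v) (f := 0) (w := 0)
      (fun a r => by simp [h1]) (fun a r => by simp) ξ).1
    simpa [weightPairing] using this

namespace IsWeightBasis

variable {ρ : Torus k →* Orth m} {e f : Fin n → Euc m} {w : Fin n → Fin k → ℤ}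

theorem inner_left_left (h : IsWeightBasis ρ e f w) (i j : Fin n) :
    inner ℝ (e i) (e j) = if i = j then (1 : ℝ) else 0 :=
  orthonormal_iff_ite.1 h.orthonormal_left i j

theorem inner_right_right (h : IsWeightBasis ρ e f w) (i j : Fin n) :
    inner ℝ (f i) (f j) = if i = j then (1 : ℝ) else 0 :=
  orthonormal_iff_ite.1 h.orthonormal_right i j

theorem inner_right_left (h : IsWeightBasis ρ e f w) (i j : Fin n) :
    inner ℝ (f i) (e j) = (0 : ℝ) := by
  rw [real_inner_comm, h.inner_left_right]

end IsWeightBasis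

/-- The orthogonal projection to the plane of the orthonormal vectors `e` and `f`. -/
def planeProj (e f : Euc m) : Euc m →L[ℝ] Euc m :=
  (innerSL ℝ e).smulRight e + (innerSL ℝ f).smulRight f

/-- The projection to the plane of the orthonormal vectors `e` and `f`, followed by the rotation by
a right angle. -/
def planeRot (e f : Euc m) : Euc m →L[ℝ] Euc m :=
  (innerSL ℝ e).smulRight f - (innerSL ℝ f).smulRight e

theorem planeProj_apply (e f x : Euc m) :
    planeProj e f x = (inner ℝ e x : ℝ) • e + (inner ℝ f x : ℝ) • f := by
  simp [planeProj]

theorem planeRot_apply (e f x : Euc m) :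
    planeRot e f x = (inner ℝ e x : ℝ) • f - (inner ℝ f x : ℝ) • e := by
  simp [planeRot]

/-- The linear vector field that rotates the `i`-th plane with angular velocity `c i`. -/
def rotField (e f : Fin n → Euc m) (c : Fin n → ℝ) : Euc m →L[ℝ] Euc m :=
  ∑ i, c i • planeRot (e i) (f i)

theorem rotField_apply (e f : Fin n → Euc m) (c : Fin n → ℝ) (x : Euc m) :
    rotField e f c x = ∑ i, c i • planeRot (e i) (f i) x := by
  simp [rotField]

/-! ### The action and its orbits in a weight basis -/

namespace IsWeightBasis

variable {ρ : Torus k →* Orth m} {e f : Fin n → Euc m} {w : Fin n → Fin k → ℤ}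

/-- The component of `x` orthogonal to all planes of the weight basis is fixed. -/
theorem apply_sub_sum (h : IsWeightBasis ρ e f w) (t : Torus k) (x : Euc m) :
    ρ t (x - ∑ i, planeProj (e i) (f i) x) = x - ∑ i, planeProj (e i) (f i) x := by
  refine h.apply_compl _ (fun i => ?_) (fun i => ?_) t <;>
  simp [inner_sub_right, inner_sum, planeProj_apply, inner_add_right, inner_smul_right,
    h.inner_left_left, h.inner_left_right, h.inner_right_left, h.inner_right_right]

theorem apply_planeProj (h : IsWeightBasis ρ e f w) (ξ : Fin k → ℝ) (i : Fin n) (x : Euc m) :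
    ρ (torusExp ξ) (planeProj (e i) (f i) x) =
      Real.cos (weightPairing (w i) ξ) • planeProj (e i) (f i) x
        + Real.sin (weightPairing (w i) ξ) • planeRot (e i) (f i) x := by
  simp only [planeProj_apply, planeRot_apply, map_add, map_smul, h.apply_left, h.apply_right]
  module

/-- The action in terms of a weight basis. -/
theorem apply_torusExp (h : IsWeightBasis ρ e f w) (ξ : Fin k → ℝ) (x : Euc m) :
    ρ (torusExp ξ) x = x + ∑ i, ((Real.cos (weightPairing (w i) ξ) - 1) • planeProj (e i) (f i) x
        + Real.sin (weightPairing (w i) ξ) • planeRot (e i) (f i) x) := by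
  have h1 := h.apply_sub_sum (torusExp ξ) x
  rw [map_sub, map_sum, sub_eq_iff_eq_add] at h1
  rw [h1]
  simp only [h.apply_planeProj, Finset.sum_add_distrib, sub_smul, one_smul, Finset.sum_sub_distrib]
  abel

theorem hasDerivAt_apply (h : IsWeightBasis ρ e f w) (ξ : Fin k → ℝ) (x : Euc m) :
    HasDerivAt (fun r : ℝ => ρ (torusExp (r • ξ)) x)
      (rotField e f (fun i => weightPairing (w i) ξ) x) 0 := by
  simp only [h.apply_torusExp, weightPairing_smul, rotField_apply]
  refine HasDerivAt.const_add x ?_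
  refine HasDerivAt.fun_sum fun i _ => ?_
  have h0 : HasDerivAt (fun r : ℝ => r * weightPairing (w i) ξ) (weightPairing (w i) ξ) 0 := by
    simpa using (hasDerivAt_id (0 : ℝ)).mul_const (weightPairing (w i) ξ)
  have := ((h0.cos.sub_const 1).smul_const (planeProj (e i) (f i) x)).fun_add
    (h0.sin.smul_const (planeRot (e i) (f i) x))
  simpa using this

theorem mem_verticalSpace (h : IsWeightBasis ρ e f w) {x v : Euc m} :
    v ∈ verticalSpace ρ x ↔
      ∃ ξ : Fin k → ℝ, v = rotField e f (fun i => weightPairing (w i) ξ) x := by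
  constructor
  · intro hv
    induction hv using Submodule.span_induction with
    | mem v hv =>
      obtain ⟨ξ, hξ⟩ := hv
      exact ⟨ξ, hξ.unique (h.hasDerivAt_apply ξ x)⟩
    | zero => exact ⟨0, by simp [rotField_apply, weightPairing_zero]⟩
    | add a b _ _ ha hb =>
      obtain ⟨ξ, rfl⟩ := ha
      obtain ⟨η, rfl⟩ := hb
      exact ⟨ξ + η, by
        simp only [rotField_apply, weightPairing_add, add_smul, Finset.sum_add_distrib]⟩
    | smul c a _ ha =>
      obtain ⟨ξ, rfl⟩ := ha
      exact ⟨c • ξ, by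
        simp only [rotField_apply, weightPairing_smul, mul_smul, Finset.smul_sum]⟩
  · rintro ⟨ξ, rfl⟩
    exact Submodule.subset_span ⟨ξ, h.hasDerivAt_apply ξ x⟩

/-- A torus element fixes `x` exactly when it acts trivially on every plane in which `x` has a
nonzero component. -/
theorem apply_eq_self_iff (h : IsWeightBasis ρ e f w) (ξ : Fin k → ℝ) (x : Euc m) :
    ρ (torusExp ξ) x = x ↔
      ∀ i, planeProj (e i) (f i) x = 0 ∨ Real.cos (weightPairing (w i) ξ) = 1 := by
  rw [h.apply_torusExp, add_eq_left]
  constructor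
  · intro h0 i
    have h1 := congrArg (inner ℝ (e i)) h0
    have h2 := congrArg (inner ℝ (f i)) h0
    simp only [planeProj_apply, planeRot_apply, inner_sum, inner_add_right, inner_sub_right,
      inner_smul_right, h.inner_left_left, h.inner_left_right, h.inner_right_left,
      h.inner_right_right, mul_ite, mul_one, mul_zero, add_zero, zero_add, zero_sub, sub_zero,
      inner_zero_right, Finset.sum_add_distrib, Finset.sum_ite_eq, Finset.mem_univ, if_true,
      mul_neg, Finset.sum_neg_distrib] at h1 h2
    by_cases hc : Real.cos (weightPairing (w i) ξ) = 1
    · exact Or.inr hc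
    · left
      have hs := Real.sin_sq_add_cos_sq (weightPairing (w i) ξ)
      set C := Real.cos (weightPairing (w i) ξ)
      set S := Real.sin (weightPairing (w i) ξ)
      set p := (inner ℝ (e i) x : ℝ)
      set q := (inner ℝ (f i) x : ℝ)
      -- The component (p, q) is in the kernel of rotation minus identity, whose determinant is this
      -- number.
      have hdet : (C - 1) ^ 2 + S ^ 2 ≠ 0 := by
        have : C - 1 ≠ 0 := sub_ne_zero.mpr hc
        positivity
      have hp : ((C - 1) ^ 2 + S ^ 2) * p = 0 := by linear_combination (C - 1) * h1 + S * h2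
      have hq : ((C - 1) ^ 2 + S ^ 2) * q = 0 := by linear_combination (C - 1) * h2 - S * h1
      have hp0 : p = 0 := by simpa [hdet] using hp
      have hq0 : q = 0 := by simpa [hdet] using hq
      rw [planeProj_apply, show (inner ℝ (e i) x : ℝ) = 0 from hp0,
        show (inner ℝ (f i) x : ℝ) = 0 from hq0]
      simp
  · intro h0
    refine Finset.sum_eq_zero fun i _ => ?_
    rcases h0 i with h1 | h1
    · have hp := congrArg (inner ℝ (e i)) h1
      have hq := congrArg (inner ℝ (f i)) h1
      simp only [planeProj_apply, inner_add_right, inner_smul_right, h.inner_left_left,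
        h.inner_left_right, h.inner_right_left, h.inner_right_right, if_true, mul_one, mul_zero,
        add_zero, zero_add, inner_zero_right] at hp hq
      rw [h1, planeRot_apply, hp, hq]
      simp
    · have hs := Real.sin_sq_add_cos_sq (weightPairing (w i) ξ)
      rw [h1] at hs
      have hs0 : Real.sin (weightPairing (w i) ξ) = 0 := by
        have : Real.sin (weightPairing (w i) ξ) ^ 2 = 0 := by linarith
        simpa using this
      rw [h1, hs0]
      simp

end IsWeightBasis

/-! ### Independent weights -/

theorem exists_int_multiple {ι : Type*} [Finite ι] (q : ι → ℚ) :
    ∃ N : ℤ, N ≠ 0 ∧ ∃ z : ι → ℤ, ∀ i, (z i : ℚ) = N * q i := by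
  obtain ⟨⟨b, hb⟩, h⟩ := IsLocalization.exist_integer_multiples_of_finite (nonZeroDivisors ℤ) q
  choose z hz using h
  refine ⟨b, nonZeroDivisors.ne_zero hb, z, fun i => ?_⟩
  have := hz i
  simpa [Algebra.smul_def] using this

/-- Each weight `w i` is separated from all the others by a coweight. -/
def HasDualCoweights (w : Fin n → Fin k → ℤ) : Prop :=
  ∀ i, ∃ ξ : Fin k → ℤ, ∑ a, w i a * ξ a ≠ 0 ∧ ∀ j ≠ i, ∑ a, w j a * ξ a = 0

/-- Linear algebra over ℚ. If w_i lies in the span of the other weights, clearing denominators gives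
an integral relation. If not, a functional vanishing on the others but not on w_i gives, after
clearing denominators, a coweight that was assumed not to exist. -/
theorem exists_relation_of_not_hasDualCoweights {w : Fin n → Fin k → ℤ}
    (h : ¬ HasDualCoweights w) :
    ∃ (i : Fin n) (c : Fin n → ℤ), c i ≠ 0 ∧ ∀ a, ∑ j, c j * w j a = 0 := by
  unfold HasDualCoweights at h
  push Not at h
  obtain ⟨i, hi⟩ := h
  refine ⟨i, ?_⟩
  let W : Fin n → Fin k → ℚ := fun j a => w j a
  -- Replacing the i-th vector by 0 removes it from the span while keeping the index type.
  by_cases hmem : W i ∈ Submodule.span ℚ (Set.range fun j => if j = i then 0 else W j)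
  · obtain ⟨c, hc⟩ := (Submodule.mem_span_range_iff_exists_fun ℚ).1 hmem
    obtain ⟨N, hN, z, hz⟩ := exists_int_multiple (fun j => if j = i then -1 else c j)
    refine ⟨z, fun h0 => hN ?_, fun a => ?_⟩
    · have := hz i
      rw [h0] at this
      simpa using this
    · have h1 : ∑ j, (z j : ℚ) * w j a = 0 := by
        have h2 := congrFun hc a
        simp only [Finset.sum_apply, Pi.smul_apply, smul_eq_mul, W] at h2
        have h3 : ∀ j, (z j : ℚ) * w j a = N * (c j * (if j = i then (0 : Fin k → ℚ) else W j) a)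
            - N * (if j = i then (w i a : ℚ) else 0) := by
          intro j
          rw [hz j]
          split_ifs with hj
          · subst hj
            simp
          · simp only [W]
            ring
        rw [Finset.sum_congr rfl fun j _ => h3 j, Finset.sum_sub_distrib, ← Finset.mul_sum,
          ← Finset.mul_sum, h2]
        simp
      exact_mod_cast h1
  · exfalso
    obtain ⟨g, hg, hker⟩ := Submodule.exists_le_ker_of_notMem hmem
    have hgsum : ∀ v : Fin k → ℚ, g v = ∑ a, v a * g (Pi.single a 1) := by
      intro v
      conv_lhs => rw [← Finset.univ_sum_single v]
      rw [map_sum]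
      refine Finset.sum_congr rfl fun a _ => ?_
      rw [← smul_eq_mul, ← map_smul, ← Pi.single_smul, smul_eq_mul, mul_one]
    obtain ⟨N, hN, z, hz⟩ := exists_int_multiple (fun a => g (Pi.single a 1))
    have hpair : ∀ j, ((∑ a, w j a * z a : ℤ) : ℚ) = N * g (W j) := by
      intro j
      push_cast
      rw [hgsum, Finset.mul_sum]
      refine Finset.sum_congr rfl fun a _ => ?_
      rw [hz a]
      simp only [W]
      ring
    obtain ⟨j, hj, hne⟩ := hi z (by
      intro h0
      have := hpair i
      rw [h0] at this
      simp [hN, hg] at this)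
    apply hne
    have h0 : g (W j) = 0 := by
      have := hker (Submodule.subset_span ⟨j, rfl⟩)
      simpa [hj] using this
    have := hpair j
    rw [h0, mul_zero] at this
    exact_mod_cast this

theorem weightPairing_intCast (w ξ : Fin k → ℤ) :
    weightPairing w (fun a => (ξ a : ℝ)) = ((∑ a, w a * ξ a : ℤ) : ℝ) := by
  simp [weightPairing]

/-- The coweights can be chosen primitive. -/
theorem HasDualCoweights.exists_primitive {w : Fin n → Fin k → ℤ} (h : HasDualCoweights w)
    (i : Fin n) : ∃ ξ u : Fin k → ℤ, ∑ a, u a * ξ a = 1 ∧ ∑ a, w i a * ξ a ≠ 0 ∧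
      ∀ j ≠ i, ∑ a, w j a * ξ a = 0 := by
  obtain ⟨ξ, hξ, hξ'⟩ := h i
  -- Divide ξ by the greatest common divisor of its entries. The Bézout coefficients u then certify
  -- that the quotient η is primitive.
  let I : Ideal ℤ := Ideal.span (Set.range ξ)
  have hgen : ∀ a, ∃ η : ℤ, ξ a = Submodule.IsPrincipal.generator I * η := fun a =>
    (Submodule.IsPrincipal.mem_iff_generator_dvd I).1 (Ideal.subset_span ⟨a, rfl⟩)
  choose η hη using hgen
  obtain ⟨u, hu⟩ := (Ideal.mem_span_range_iff_exists_fun).1 (Submodule.IsPrincipal.generator_mem I)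
  set g := Submodule.IsPrincipal.generator I
  have hsum : ∀ v : Fin k → ℤ, ∑ a, v a * ξ a = g * ∑ a, v a * η a := by
    intro v
    rw [Finset.mul_sum]
    refine Finset.sum_congr rfl fun a _ => ?_
    rw [hη a]
    ring
  rw [hsum] at hξ hu
  have hg : g ≠ 0 := left_ne_zero_of_mul hξ
  refine ⟨η, u, mul_left_cancel₀ hg (by rw [hu, mul_one]), right_ne_zero_of_mul hξ, fun j hj => ?_⟩
  have := hξ' j hj
  rw [hsum] at this
  exact (mul_eq_zero.1 this).resolve_left hg

/-! ### Split actions have independent weights -/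

section Split

variable {ρ : Torus k →* Orth m} {e f : Fin n → Euc m} {w : Fin n → Fin k → ℤ}

theorem IsWeightBasis.finrank_plane (h : IsWeightBasis ρ e f w) (i : Fin n) :
    Module.finrank ℝ (Submodule.span ℝ {e i, f i}) = 2 := by
  have hon : Orthonormal ℝ ![e i, f i] := by
    rw [orthonormal_iff_ite]
    intro a b
    fin_cases a <;> fin_cases b <;>
      simp [h.inner_left_right, h.inner_right_left, h.orthonormal_left.1 i,
        h.orthonormal_right.1 i]
  have hr : Set.range ![e i, f i] = {e i, f i} := by
    rw [Set.pair_comm]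
    ext x
    simp
  rw [← hr, finrank_span_eq_card hon.linearIndependent, Fintype.card_fin]

theorem IsWeightBasis.apply_mem_plane (h : IsWeightBasis ρ e f w) (i : Fin n) (t : Torus k)
    {v : Euc m} (hv : v ∈ Submodule.span ℝ {e i, f i}) :
    ρ t v ∈ Submodule.span ℝ {e i, f i} := by
  obtain ⟨ξ, rfl⟩ := torusExp_surjective t
  obtain ⟨a, b, rfl⟩ := Submodule.mem_span_pair.1 hv
  have he : e i ∈ Submodule.span ℝ {e i, f i} := Submodule.subset_span (by simp)
  have hf : f i ∈ Submodule.span ℝ {e i, f i} := Submodule.subset_span (by simp)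
  rw [map_add, map_smul, map_smul, h.apply_left, h.apply_right]
  exact Submodule.add_mem _
    (Submodule.smul_mem _ _ (Submodule.add_mem _ (Submodule.smul_mem _ _ he)
      (Submodule.smul_mem _ _ hf)))
    (Submodule.smul_mem _ _ (Submodule.add_mem _ (Submodule.smul_mem _ _ he)
      (Submodule.smul_mem _ _ hf)))

theorem IsWeightBasis.exists_weightPairing_eq (h : IsWeightBasis ρ e f w) (i : Fin n) (r : ℝ) :
    ∃ ξ, weightPairing (w i) ξ = r := by
  obtain ⟨a, ha⟩ := Function.ne_iff.1 (h.weight_ne_zero i)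
  have ha' : (w i a : ℝ) ≠ 0 := by exact_mod_cast ha
  refine ⟨(r / w i a) • Pi.single a 1, ?_⟩
  rw [weightPairing_smul]
  simp [weightPairing, Pi.single_apply, ha']

/-- A parity obstruction: under a relation with c_i ≠ 0, an element that acts trivially off the i-th
plane cannot rotate that plane by π / c_i. -/
theorem IsWeightBasis.hasDualCoweights_of_isSplit (h : IsWeightBasis ρ e f w)
    (hs : IsSplit ρ) : HasDualCoweights w := by
  by_contra hD
  obtain ⟨i, c, hci, hc⟩ := exists_relation_of_not_hasDualCoweights hD
  have hei : e i ∈ Submodule.span ℝ {e i, f i} := Submodule.subset_span (by simp)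
  have hfi : f i ∈ Submodule.span ℝ {e i, f i} := Submodule.subset_span (by simp)
  have hci' : (c i : ℝ) ≠ 0 := by exact_mod_cast hci
  obtain ⟨γ, -, -, hrot, hfix⟩ := hs (Submodule.span ℝ {e i, f i}) (h.finrank_plane i)
    (fun t v hv => h.apply_mem_plane i t hv) (by
      intro hfix
      obtain ⟨ξ, hξ⟩ := h.exists_weightPairing_eq i Real.pi
      have h1 := hfix (torusExp ξ) (e i) hei
      rw [h.apply_left, hξ] at h1
      have h2 := congrArg (inner ℝ (e i)) h1
      simp only [Real.cos_pi, Real.sin_pi, zero_smul, add_zero, inner_smul_right,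
        h.inner_left_left, if_true] at h2
      norm_num at h2)
  obtain ⟨z, hz⟩ := hrot (e i) hei
    (Real.cos (Real.pi / c i) • e i + Real.sin (Real.pi / c i) • f i)
    (Submodule.add_mem _ (Submodule.smul_mem _ _ hei) (Submodule.smul_mem _ _ hfi)) (by
      have h1 : ‖Real.cos (Real.pi / c i) • e i + Real.sin (Real.pi / c i) • f i‖ ^ 2 = 1 := by
        rw [← real_inner_self_eq_norm_sq]
        simp only [inner_add_left, inner_add_right, inner_smul_left, inner_smul_right,
          h.inner_left_left, h.inner_right_right, h.inner_left_right, h.inner_right_left]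
        simp only [conj_trivial, if_true, mul_one, mul_zero, add_zero, zero_add]
        nlinarith [Real.sin_sq_add_cos_sq (Real.pi / c i)]
      rw [h.orthonormal_left.1 i]
      exact ((pow_eq_one_iff_of_nonneg (norm_nonneg _) two_ne_zero).1 h1).symm)
  obtain ⟨η, hη⟩ := torusExp_surjective (γ z)
  rw [← hη, h.apply_left] at hz
  have hcos := congrArg (inner ℝ (e i)) hz
  have hsin := congrArg (inner ℝ (f i)) hz
  simp only [inner_add_right, inner_smul_right, h.inner_left_left, h.inner_right_right,
    h.inner_left_right, h.inner_right_left, if_true, mul_one, mul_zero, add_zero, zero_add]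
    at hcos hsin
  obtain ⟨l, hl⟩ := Real.Angle.angle_eq_iff_two_pi_dvd_sub.1 (Real.Angle.cos_sin_inj hcos hsin)
  -- All other planes are fixed, so their angles are multiples of 2π. The condition j ≠ i stands
  -- inside the existential so that `choose` yields a function on all indices, with a dummy value at
  -- i.
  have hj : ∀ j, ∃ l : ℤ, j ≠ i → weightPairing (w j) η = l * (2 * Real.pi) := by
    intro j
    by_cases hji : j = i
    · exact ⟨0, fun h => absurd hji h⟩
    have hej : e j ∈ (Submodule.span ℝ {e i, f i})ᗮ := by
      rw [Submodule.mem_orthogonal]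
      intro u hu
      obtain ⟨a, b, rfl⟩ := Submodule.mem_span_pair.1 hu
      simp [inner_add_left, inner_smul_left, h.inner_left_left, h.inner_right_left, Ne.symm hji]
    have h1 := hfix z (e j) hej
    rw [← hη, h.apply_left] at h1
    have h2 := congrArg (inner ℝ (e j)) h1
    simp only [inner_add_right, inner_smul_right, h.inner_left_left, h.inner_left_right, if_true,
      mul_one, mul_zero, add_zero] at h2
    obtain ⟨l, hl⟩ := (Real.cos_eq_one_iff _).1 h2
    exact ⟨l, fun _ => hl.symm⟩
  choose l' hl' using hj
  have hrel : ∑ j, (c j : ℝ) * weightPairing (w j) η = 0 := by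
    simp only [weightPairing, Finset.mul_sum]
    rw [Finset.sum_comm]
    refine Finset.sum_eq_zero fun a _ => ?_
    have : ∑ j, (c j : ℝ) * w j a = 0 := by exact_mod_cast hc a
    simp only [← mul_assoc, ← Finset.sum_mul, this, zero_mul]
  rw [← Finset.add_sum_erase _ _ (Finset.mem_univ i),
    Finset.sum_congr rfl fun j hj => by rw [hl' j (Finset.ne_of_mem_erase hj)]] at hrel
  have hw : weightPairing (w i) η = Real.pi / c i + 2 * Real.pi * l := by linarith
  rw [hw] at hrel
  -- Evaluated on η, the relation says that π times an odd integer is zero.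
  have hrel' : Real.pi * (1 + 2 * (c i * l + ∑ j ∈ Finset.univ.erase i, (c j : ℝ) * l' j)) = 0 := by
    have hsum : ∑ j ∈ Finset.univ.erase i, (c j : ℝ) * (l' j * (2 * Real.pi)) =
        (∑ j ∈ Finset.univ.erase i, (c j : ℝ) * l' j) * (2 * Real.pi) := by
      rw [Finset.sum_mul]
      exact Finset.sum_congr rfl fun j _ => by ring
    have hdiv : (c i : ℝ) * (Real.pi / c i) = Real.pi := by field_simp
    rw [hsum, mul_add, hdiv] at hrel
    linear_combination hrel
  have h0 := (mul_eq_zero.1 hrel').resolve_left Real.pi_ne_zero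
  have h0' : 1 + 2 * (c i * l + ∑ j ∈ Finset.univ.erase i, c j * l' j) = 0 := by exact_mod_cast h0
  omega

/-- The circle subgroup of the torus with the coweight `ξ`. -/
def coweightHom (ξ : Fin k → ℤ) : Circle →* Torus k where
  toFun z := fun a => z ^ ξ a
  map_one' := by ext; simp
  map_mul' x y := by
    funext a
    simp [mul_zpow]

theorem coweightHom_exp (ξ : Fin k → ℤ) (r : ℝ) :
    coweightHom ξ (Circle.exp r) = torusExp (r • fun a => (ξ a : ℝ)) := by
  funext a
  simp [coweightHom, torusExp, mul_comm r]

theorem continuous_coweightHom (ξ : Fin k → ℤ) : Continuous (coweightHom ξ) :=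
  continuous_pi fun a => continuous_zpow (ξ a)

/-- The Bézout relation recovers z from its image, as the product of the powers (z ^ ξ a) ^ u a. -/
theorem coweightHom_injective {ξ u : Fin k → ℤ} (h : ∑ a, u a * ξ a = 1) :
    Function.Injective (coweightHom ξ) := by
  rw [injective_iff_map_eq_one]
  intro z hz
  have h1 : ∀ a, z ^ ξ a = 1 := fun a => congrFun hz a
  have h2 : ∀ s : Finset (Fin k), z ^ (∑ a ∈ s, u a * ξ a) = 1 := by
    intro s
    induction s using Finset.induction_on with
    | empty => simp
    | insert a s ha ih => rw [Finset.sum_insert ha, zpow_add, ih, mul_one, mul_comm, zpow_mul, h1,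
        one_zpow]
  simpa [h] using h2 Finset.univ

theorem exists_rotation {p q p' q' : ℝ} (h : p ^ 2 + q ^ 2 = p' ^ 2 + q' ^ 2) :
    ∃ r : ℝ, p' = p * Real.cos r - q * Real.sin r ∧ q' = p * Real.sin r + q * Real.cos r := by
  by_cases h0 : p ^ 2 + q ^ 2 = 0
  · have hp : p = 0 := by nlinarith [sq_nonneg p, sq_nonneg q]
    have hq : q = 0 := by nlinarith [sq_nonneg p, sq_nonneg q]
    have hp' : p' = 0 := by nlinarith [sq_nonneg p', sq_nonneg q']
    have hq' : q' = 0 := by nlinarith [sq_nonneg p', sq_nonneg q']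
    exact ⟨0, by simp [hp, hp', hq], by simp [hp, hq', hq]⟩
  -- Z is the quotient of p' + q' i by p + q i; its argument is the required angle.
  · let Z : ℂ := ⟨(p * p' + q * q') / (p ^ 2 + q ^ 2), (p * q' - q * p') / (p ^ 2 + q ^ 2)⟩
    have hZ : ‖Z‖ = 1 := by
      have : ‖Z‖ ^ 2 = 1 := by
        rw [Complex.sq_norm, Complex.normSq_mk]
        have h2 : (p * p' + q * q') ^ 2 + (p * q' - q * p') ^ 2 = (p ^ 2 + q ^ 2) ^ 2 := by
          linear_combination -(p ^ 2 + q ^ 2) * h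
        field_simp
        linear_combination h2
      exact (pow_eq_one_iff_of_nonneg (norm_nonneg _) two_ne_zero).1 this
    have hZ0 : Z ≠ 0 := by
      intro h
      rw [h] at hZ
      simp at hZ
    refine ⟨Complex.arg Z, ?_, ?_⟩
    · rw [Complex.cos_arg hZ0, Complex.sin_arg, hZ]
      simp only [Z]
      field_simp
      ring
    · rw [Complex.cos_arg hZ0, Complex.sin_arg, hZ]
      simp only [Z]
      field_simp
      ring

theorem IsWeightBasis.apply_coweight (h : IsWeightBasis ρ e f w) {i : Fin n} {ξ : Fin k → ℝ}
    (hξ : ∀ j ≠ i, weightPairing (w j) ξ = 0) (r : ℝ) (x : Euc m) :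
    ρ (torusExp (r • ξ)) x =
      x + (Real.cos (r * weightPairing (w i) ξ) - 1) • planeProj (e i) (f i) x
        + Real.sin (r * weightPairing (w i) ξ) • planeRot (e i) (f i) x := by
  rw [h.apply_torusExp, Finset.sum_eq_single i, ← add_assoc, weightPairing_smul]
  · intro j _ hj
    simp [weightPairing_smul, hξ j hj]
  · simp

/-- An invariant plane V that is not fixed has a nonzero component in some plane of the weight
basis. The circle rotating only that plane isolates this component and its rotation by a right angle
inside V, so V is that plane and the same circle serves for it. -/
theorem IsWeightBasis.isSplit_of_hasDualCoweights (h : IsWeightBasis ρ e f w)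
    (hD : HasDualCoweights w) : IsSplit ρ := by
  intro V hV hinv hnfix
  obtain ⟨i, v, hvV, hvi⟩ : ∃ i, ∃ v ∈ V, planeProj (e i) (f i) v ≠ 0 := by
    by_contra! hcon
    apply hnfix
    intro t v hv
    have := h.apply_sub_sum t v
    simpa [Finset.sum_eq_zero fun i _ => hcon i v hv] using this
  obtain ⟨ξ, u, hu, hi, hj⟩ := hD.exists_primitive i
  set ξ' : Fin k → ℝ := fun a => (ξ a : ℝ) with hξ'
  set μ : ℝ := weightPairing (w i) ξ' with hμ
  have hμ0 : μ ≠ 0 := by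
    rw [hμ, hξ', weightPairing_intCast]
    exact_mod_cast hi
  have hj' : ∀ j ≠ i, weightPairing (w j) ξ' = 0 := by
    intro j hji
    rw [hξ', weightPairing_intCast, hj j hji, Int.cast_zero]
  have hact := h.apply_coweight hj'
  -- A half turn changes v by -2 times its component in the i-th plane; the quarter turn below then
  -- produces the rotated component.
  have hy : planeProj (e i) (f i) v ∈ V := by
    have h1 := hinv (torusExp ((Real.pi / μ) • ξ')) v hvV
    rw [hact, div_mul_cancel₀ _ hμ0, Real.cos_pi, Real.sin_pi, zero_smul, add_zero] at h1
    have h2 := (V.add_mem_iff_right hvV).1 h1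
    exact (V.smul_mem_iff (by norm_num)).1 h2
  have hy' : planeRot (e i) (f i) v ∈ V := by
    have h1 := hinv (torusExp ((Real.pi / 2 / μ) • ξ')) v hvV
    rw [hact, div_mul_cancel₀ _ hμ0, Real.cos_pi_div_two, Real.sin_pi_div_two, one_smul] at h1
    exact (V.add_mem_iff_right (V.add_mem hvV (V.smul_mem _ hy))).1 h1
  have hVi : Submodule.span ℝ {e i, f i} = V := by
    refine Submodule.eq_of_le_of_finrank_eq ?_ (by rw [h.finrank_plane, hV])
    rw [Submodule.span_le]
    rw [planeProj_apply] at hy hvi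
    rw [planeRot_apply] at hy'
    set p : ℝ := inner ℝ (e i) v
    set q : ℝ := inner ℝ (f i) v
    have hpq : p ^ 2 + q ^ 2 ≠ 0 := by
      intro h0
      have hp : p = 0 := by nlinarith [sq_nonneg p, sq_nonneg q]
      have hq : q = 0 := by nlinarith [sq_nonneg p, sq_nonneg q]
      exact hvi (by rw [hp, hq]; simp)
    rintro x (rfl | rfl)
    · rw [SetLike.mem_coe, ← V.smul_mem_iff hpq]
      have := V.sub_mem (V.smul_mem p hy) (V.smul_mem q hy')
      convert this using 1
      module
    · rw [SetLike.mem_coe, ← V.smul_mem_iff hpq]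
      have := V.add_mem (V.smul_mem q hy) (V.smul_mem p hy')
      convert this using 1
      module
  subst hVi
  refine ⟨coweightHom ξ, continuous_coweightHom ξ, coweightHom_injective hu, ?_, ?_⟩
  · intro v hv w' hw' hnorm
    obtain ⟨p, q, rfl⟩ := Submodule.mem_span_pair.1 hv
    obtain ⟨p', q', rfl⟩ := Submodule.mem_span_pair.1 hw'
    have hsq : ∀ a b : ℝ, ‖a • e i + b • f i‖ ^ 2 = a ^ 2 + b ^ 2 := by
      intro a b
      rw [← real_inner_self_eq_norm_sq]
      simp only [inner_add_left, inner_add_right, inner_smul_left, inner_smul_right,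
        h.inner_left_left, h.inner_right_right, h.inner_left_right, h.inner_right_left]
      simp only [conj_trivial, if_true, mul_one, mul_zero, add_zero, zero_add]
      ring
    obtain ⟨r, hr, hr'⟩ := exists_rotation (p := p) (q := q) (p' := p') (q' := q')
      (by rw [← hsq, ← hsq, hnorm])
    refine ⟨Circle.exp (r / μ), ?_⟩
    rw [coweightHom_exp, map_add, map_smul, map_smul, h.apply_left, h.apply_right,
      weightPairing_smul, ← hξ', ← hμ, div_mul_cancel₀ _ hμ0, hr, hr']
    module
  · intro z v hv
    have hi0 : planeProj (e i) (f i) v = 0 := by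
      rw [Submodule.mem_orthogonal] at hv
      rw [planeProj_apply, hv (e i) (Submodule.subset_span (by simp)),
        hv (f i) (Submodule.subset_span (by simp))]
      simp
    rw [← Circle.exp_arg z, coweightHom_exp, h.apply_eq_self_iff]
    intro j
    by_cases hji : j = i
    · exact Or.inl (hji ▸ hi0)
    · right
      rw [weightPairing_smul, ← hξ', hj' j hji, mul_zero, Real.cos_zero]

end Split

/-! ### Flat metrics -/

theorem contDiffAt_matrix_det {E : Type*} [NormedAddCommGroup E] [NormedSpace ℝ E] {d : ℕ}
    {N : WithTop ℕ∞} {g : E → Matrix (Fin d) (Fin d) ℝ} {x : E}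
    (h : ∀ i j, ContDiffAt ℝ N (fun y => g y i j) x) :
    ContDiffAt ℝ N (fun y => (g y).det) x := by
  simp only [Matrix.det_apply']
  refine ContDiffAt.sum fun σ _ => ?_
  exact contDiffAt_const.mul (contDiffAt_prod fun i _ => h _ _)

theorem contDiffAt_matrix_inv {E : Type*} [NormedAddCommGroup E] [NormedSpace ℝ E] {d : ℕ}
    {N : WithTop ℕ∞} {g : E → Matrix (Fin d) (Fin d) ℝ} {x : E}
    (h : ∀ i j, ContDiffAt ℝ N (fun y => g y i j) x) (hdet : (g x).det ≠ 0) (i j : Fin d) :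
    ContDiffAt ℝ N (fun y => (g y)⁻¹ i j) x := by
  simp only [Matrix.inv_def, Ring.inverse_eq_inv', Matrix.smul_apply, smul_eq_mul,
    Matrix.adjugate_apply]
  refine ((contDiffAt_matrix_det h).inv hdet).mul (contDiffAt_matrix_det fun a b => ?_)
  simp only [Matrix.updateRow_apply]
  split_ifs
  · exact contDiffAt_const
  · exact h a b

/-! ### Partial derivatives of vector-valued maps -/

section Partial

variable {d : ℕ} {F : Type*} [NormedAddCommGroup F] [InnerProductSpace ℝ F]

/-- The partial derivative `∂_i G` at `u` of a vector-valued map. -/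
def partialDeriv (i : Fin d) (G : Euc d → F) (u : Euc d) : F := fderiv ℝ G u (basisVec i)

theorem sum_smul_basisVec (a : Euc d) : ∑ i, a i • basisVec i = a := by
  have := (EuclideanSpace.basisFun (Fin d) ℝ).sum_repr a
  simpa [basisVec] using this

theorem fderiv_apply_eq_sum (G : Euc d → F) (u a : Euc d) :
    fderiv ℝ G u a = ∑ i, a i • partialDeriv i G u := by
  conv_lhs => rw [← sum_smul_basisVec a]
  simp [partialDeriv]

theorem contDiffOn_partialDeriv {U : Set (Euc d)} (hU : IsOpen U) {G : Euc d → F}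
    (hG : ContDiffOn ℝ ∞ G U) (i : Fin d) : ContDiffOn ℝ ∞ (partialDeriv i G) U := by
  have : ContDiffOn ℝ ∞ (fderiv ℝ G) U := hG.fderiv_of_isOpen hU (by simp)
  exact this.clm_apply contDiffOn_const

theorem differentiableAt_of_contDiffOn {U : Set (Euc d)} (hU : IsOpen U) {G : Euc d → F}
    (hG : ContDiffOn ℝ ∞ G U) {u : Euc d} (hu : u ∈ U) : DifferentiableAt ℝ G u :=
  (hG.contDiffAt (hU.mem_nhds hu)).differentiableAt (by simp)

theorem partialDeriv_comm {U : Set (Euc d)} (hU : IsOpen U) {G : Euc d → F}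
    (hG : ContDiffOn ℝ ∞ G U) {u : Euc d} (hu : u ∈ U) (i j : Fin d) :
    partialDeriv i (partialDeriv j G) u = partialDeriv j (partialDeriv i G) u := by
  have h1 : DifferentiableAt ℝ (fderiv ℝ G) u :=
    ((hG.fderiv_of_isOpen hU (by simp) : ContDiffOn ℝ ∞ (fderiv ℝ G) U).contDiffAt
      (hU.mem_nhds hu)).differentiableAt (by simp)
  have h2 : ∀ i j, partialDeriv i (partialDeriv j G) u =
      fderiv ℝ (fderiv ℝ G) u (basisVec i) (basisVec j) := by
    intro i j
    have : partialDeriv j G = fun x => fderiv ℝ G x (basisVec j) := rfl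
    rw [partialDeriv, this, fderiv_clm_apply h1 (differentiableAt_const _)]
    simp
  rw [h2, h2]
  exact ((hG.contDiffAt (hU.mem_nhds hu)).isSymmSndFDerivAt (by
    simp only [minSmoothness_of_isRCLikeNormedField]
    exact (WithTop.coe_le_coe.2 le_top : ((2 : ℕ∞) : WithTop ℕ∞) ≤ ∞))) _ _

theorem pderiv_inner {U : Set (Euc d)} (hU : IsOpen U) {A B : Euc d → F}
    (hA : ContDiffOn ℝ ∞ A U) (hB : ContDiffOn ℝ ∞ B U) {φ : Euc d → ℝ}
    (hφ : ∀ u ∈ U, φ u = inner ℝ (A u) (B u)) {u : Euc d} (hu : u ∈ U) (i : Fin d) :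
    pderiv i φ u = inner ℝ (partialDeriv i A u) (B u) + inner ℝ (A u) (partialDeriv i B u) := by
  have h1 : φ =ᶠ[𝓝 u] fun x => inner ℝ (A x) (B x) := by
    filter_upwards [hU.mem_nhds hu] with x hx using hφ x hx
  rw [pderiv, h1.fderiv_eq, fderiv_inner_apply ℝ (differentiableAt_of_contDiffOn hU hA hu)
    (differentiableAt_of_contDiffOn hU hB hu), add_comm]
  rfl

/-! ### Immersions with constant tangent space -/

section Flat

variable {U : Set (Euc d)} {G : Euc d → F} {L : Submodule ℝ F}
  {g : Euc d → Matrix (Fin d) (Fin d) ℝ}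

/-- A vector in the kernel of the Gram matrix is sent by the derivative of G to a vector of length
zero. -/
theorem isUnit_det_of_gram
    (hinj : ∀ u ∈ U, Function.Injective (fderiv ℝ G u))
    (hg : ∀ u ∈ U, ∀ i j, g u i j = inner ℝ (partialDeriv i G u) (partialDeriv j G u))
    {u : Euc d} (hu : u ∈ U) : IsUnit (g u).det := by
  rw [← Matrix.isUnit_iff_isUnit_det, ← Matrix.mulVec_injective_iff_isUnit]
  intro a b hab
  have h0 : (g u).mulVec (a - b) = 0 := by rw [Matrix.mulVec_sub, hab, sub_self]
  set c : Fin d → ℝ := a - b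
  have h1 : fderiv ℝ G u (WithLp.toLp 2 c) = 0 := by
    rw [← inner_self_eq_zero (𝕜 := ℝ), fderiv_apply_eq_sum]
    simp only [sum_inner, inner_sum, inner_smul_left, inner_smul_right, conj_trivial]
    refine Finset.sum_eq_zero fun i _ => ?_
    have h2 := congrFun h0 i
    simp only [Matrix.mulVec, dotProduct, Pi.zero_apply] at h2
    rw [← mul_zero (c i), ← h2]
    congr 1
    refine Finset.sum_congr rfl fun j _ => ?_
    rw [hg u hu i j, real_inner_comm]
    ring
  have h2 := hinj u hu (h1.trans (map_zero _).symm)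
  have h3 : c = 0 := by
    funext i
    exact congrArg (fun v : Euc d => v i) h2
  exact sub_eq_zero.1 h3

theorem contDiffOn_gram (hU : IsOpen U) (hG : ContDiffOn ℝ ∞ G U)
    (hg : ∀ u ∈ U, ∀ i j, g u i j = inner ℝ (partialDeriv i G u) (partialDeriv j G u))
    (i j : Fin d) : ContDiffOn ℝ ∞ (fun u => g u i j) U :=
  ((contDiffOn_partialDeriv hU hG i).inner ℝ (contDiffOn_partialDeriv hU hG j)).congr
    fun u hu => hg u hu i j

variable [FiniteDimensional ℝ F]

/-- The projection to the orthogonal complement of L annihilates A near u, hence also its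
derivative. -/
theorem partialDeriv_mem_of_forall_mem (hU : IsOpen U) {A : Euc d → F} (hA : ContDiffOn ℝ ∞ A U)
    (hmem : ∀ u ∈ U, A u ∈ L) {u : Euc d} (hu : u ∈ U) (i : Fin d) : partialDeriv i A u ∈ L := by
  have hd := (differentiableAt_of_contDiffOn hU hA hu).hasFDerivAt
  have hP : HasFDerivAt (fun x => Lᗮ.starProjection (A x))
      (Lᗮ.starProjection.comp (fderiv ℝ A u)) u :=
    Lᗮ.starProjection.hasFDerivAt.comp u hd
  have h0 : (fun x => Lᗮ.starProjection (A x)) =ᶠ[𝓝 u] fun _ => 0 := by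
    filter_upwards [hU.mem_nhds hu] with x hx
    rw [Submodule.starProjection_apply_eq_zero_iff, Submodule.orthogonal_orthogonal]
    exact hmem x hx
  have h1 := (hP.congr_of_eventuallyEq h0.symm).unique (hasFDerivAt_const (0 : F) u)
  have h2 := congrArg (fun T => T (basisVec i)) h1
  simp only [ContinuousLinearMap.comp_apply, zero_apply] at h2
  rwa [Submodule.starProjection_apply_eq_zero_iff, Submodule.orthogonal_orthogonal] at h2

/-- The Gauss formula without second fundamental form. Since the tangent space is constantly L, the
second derivatives of G are tangent and expand in the frame ∂_q G with coefficients a q. Symmetry of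
second derivatives collapses the three metric derivatives to 2⟨∂_i ∂_j G, ∂_l G⟩, and the inverse
metric returns a. -/
theorem sum_christoffel_smul (hU : IsOpen U) (hG : ContDiffOn ℝ ∞ G U)
    (hinj : ∀ u ∈ U, Function.Injective (fderiv ℝ G u))
    (hrange : ∀ u ∈ U, LinearMap.range (fderiv ℝ G u).toLinearMap = L)
    (hg : ∀ u ∈ U, ∀ i j, g u i j = inner ℝ (partialDeriv i G u) (partialDeriv j G u))
    {u : Euc d} (hu : u ∈ U) (i j : Fin d) :
    ∑ p, christoffel g p i j u • partialDeriv p G u = partialDeriv i (partialDeriv j G) u := by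
  have hD := contDiffOn_partialDeriv hU hG
  have hpd : ∀ a b c, pderiv a (fun x => g x b c) u =
      inner ℝ (partialDeriv a (partialDeriv b G) u) (partialDeriv c G u)
        + inner ℝ (partialDeriv b G u) (partialDeriv a (partialDeriv c G) u) := fun a b c =>
    pderiv_inner hU (hD b) (hD c) (fun x hx => hg x hx b c) hu a
  have hmem : partialDeriv i (partialDeriv j G) u ∈ L :=
    partialDeriv_mem_of_forall_mem hU (hD j) (fun x hx => by
      rw [← hrange x hx]
      exact ⟨basisVec j, rfl⟩) hu i
  rw [← hrange u hu] at hmem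
  obtain ⟨a, ha⟩ := hmem
  have ha' : partialDeriv i (partialDeriv j G) u = ∑ q, a q • partialDeriv q G u := by
    rw [← fderiv_apply_eq_sum]
    exact ha.symm
  have hΓ : ∀ p, christoffel g p i j u = a p := by
    intro p
    have h1 : ∀ l, pderiv i (fun x => g x j l) u + pderiv j (fun x => g x i l) u
        - pderiv l (fun x => g x i j) u = 2 * ∑ q, a q * g u q l := by
      intro l
      have h2 : inner ℝ (partialDeriv i (partialDeriv j G) u) (partialDeriv l G u) =
          ∑ q, a q * g u q l := by
        rw [ha', sum_inner]
        exact Finset.sum_congr rfl fun q _ => by rw [inner_smul_left, hg u hu]; rfl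
      rw [hpd, hpd, hpd, ← h2, partialDeriv_comm hU hG hu j i, partialDeriv_comm hU hG hu l i,
        partialDeriv_comm hU hG hu l j, real_inner_comm (partialDeriv j (partialDeriv l G) u)]
      rw [real_inner_comm (partialDeriv i (partialDeriv l G) u)]
      ring
    have hsymm : ∀ q l, g u q l = g u l q := fun q l => by
      rw [hg u hu, hg u hu, real_inner_comm]
    have hinv := Matrix.nonsing_inv_mul (g u) (isUnit_det_of_gram hinj hg hu)
    simp only [christoffel, h1]
    calc (1 / 2 : ℝ) * ∑ l, (g u)⁻¹ p l * (2 * ∑ q, a q * g u q l)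
        = ∑ l, ∑ q, a q * ((g u)⁻¹ p l * g u l q) := by
          rw [Finset.mul_sum]
          refine Finset.sum_congr rfl fun l _ => ?_
          rw [Finset.mul_sum, Finset.mul_sum, Finset.mul_sum]
          exact Finset.sum_congr rfl fun q _ => by rw [hsymm q l]; ring
      _ = ∑ q, a q * ((g u)⁻¹ * g u) p q := by
          rw [Finset.sum_comm]
          exact Finset.sum_congr rfl fun q _ => by rw [Matrix.mul_apply, Finset.mul_sum]
      _ = a p := by simp [hinv, Matrix.one_apply]
  simp only [hΓ, ha']

/-- A metric induced from a Euclidean space by an immersion with constant tangent space is flat. -/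
theorem riemannTensor_eq_zero_of_constant_range (hU : IsOpen U) (hG : ContDiffOn ℝ ∞ G U)
    (hinj : ∀ u ∈ U, Function.Injective (fderiv ℝ G u))
    (hrange : ∀ u ∈ U, LinearMap.range (fderiv ℝ G u).toLinearMap = L)
    (hg : ∀ u ∈ U, ∀ i j, g u i j = inner ℝ (partialDeriv i G u) (partialDeriv j G u))
    {u : Euc d} (hu : u ∈ U) (i j k l : Fin d) : riemannTensor g i j k l u = 0 := by
  have hD := contDiffOn_partialDeriv hU hG
  have hgc := contDiffOn_gram hU hG hg
  have hΓd : ∀ p a b, DifferentiableAt ℝ (christoffel g p a b) u := by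
    intro p a b
    have hpd : ∀ a b c, DifferentiableAt ℝ (pderiv a (fun x => g x b c)) u := fun a b c =>
      differentiableAt_of_contDiffOn hU (contDiffOn_partialDeriv hU (hgc b c) a) hu
    have hinv : ∀ b, DifferentiableAt ℝ (fun x => (g x)⁻¹ p b) u := fun b =>
      (contDiffAt_matrix_inv (N := ∞) (fun a b => (hgc a b).contDiffAt (hU.mem_nhds hu))
        (isUnit_det_of_gram hinj hg hu).ne_zero p b).differentiableAt (by simp)
    exact (DifferentiableAt.fun_sum fun b' _ =>
      (hinv b').mul (((hpd _ _ _).add (hpd _ _ _)).sub (hpd _ _ _))).const_mul _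
  have hΓ := fun {x} (hx : x ∈ U) => sum_christoffel_smul hU hG hinj hrange hg hx
  -- The product rule, applied to the expansion of ∂_j ∂_k G in the moving frame.
  have hder : ∀ i j k, ∑ p, pderiv i (christoffel g p j k) u • partialDeriv p G u =
      partialDeriv i (partialDeriv j (partialDeriv k G)) u
        - ∑ p, christoffel g p j k u • partialDeriv i (partialDeriv p G) u := by
    intro i j k
    have h1 : partialDeriv j (partialDeriv k G) =ᶠ[𝓝 u]
        fun x => ∑ p, christoffel g p j k x • partialDeriv p G x := by
      filter_upwards [hU.mem_nhds hu] with x hx using (hΓ hx j k).symm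
    rw [eq_sub_iff_add_eq, ← Finset.sum_add_distrib]
    conv_rhs => rw [partialDeriv, h1.fderiv_eq]
    rw [fderiv_fun_sum fun p _ =>
      (hΓd p j k).fun_smul (differentiableAt_of_contDiffOn hU (hD p) hu)]
    simp only [sum_apply]
    refine Finset.sum_congr rfl fun p _ => ?_
    rw [fderiv_fun_smul (hΓd p j k) (differentiableAt_of_contDiffOn hU (hD p) hu)]
    simp [pderiv, partialDeriv, add_comm]
  have hsum : ∀ i j k, ∑ p, christoffel g p j k u • partialDeriv i (partialDeriv p G) u =
      ∑ p, (∑ q, christoffel g p i q u * christoffel g q j k u) • partialDeriv p G u := by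
    intro i j k
    simp only [← hΓ hu, Finset.sum_smul, Finset.smul_sum]
    rw [Finset.sum_comm]
    refine Finset.sum_congr rfl fun p _ => Finset.sum_congr rfl fun q _ => ?_
    rw [smul_smul, mul_comm]
  -- The coefficients of the curvature are those of ∂_i ∂_j ∂_k G - ∂_j ∂_i ∂_k G in the frame,
  -- which vanishes.
  have hzero : ∑ p, (pderiv i (christoffel g p j k) u - pderiv j (christoffel g p i k) u
      + ∑ q, (christoffel g p i q u * christoffel g q j k u
        - christoffel g p j q u * christoffel g q i k u)) • partialDeriv p G u = 0 := by
    simp only [add_smul, sub_smul, Finset.sum_add_distrib, Finset.sum_sub_distrib, hder, ← hsum]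
    rw [partialDeriv_comm hU (hD k) hu i j]
    abel
  have := congrArg (fun v => inner ℝ v (partialDeriv l G u)) hzero
  simp only [sum_inner, inner_smul_left, inner_zero_left, conj_trivial, ← hg u hu] at this
  rw [riemannTensor, ← this]
  exact Finset.sum_congr rfl fun p _ => mul_comm _ _

end Flat

end Partial

/-! ### Split actions have flat quotient strata -/

/-- The projection to the orthogonal complement of the planes of a weight basis. -/
def fixedPart (e f : Fin n → Euc m) : Euc m →L[ℝ] Euc m :=
  ContinuousLinearMap.id ℝ (Euc m) - ∑ i, planeProj (e i) (f i)

theorem fixedPart_apply (e f : Fin n → Euc m) (x : Euc m) :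
    fixedPart e f x = x - ∑ i, planeProj (e i) (f i) x := by
  simp [fixedPart]

/-- The distance of `x` from the orthogonal complement of the plane of `e` and `f`. -/
def radius (e f x : Euc m) : ℝ := √((inner ℝ e x : ℝ) ^ 2 + (inner ℝ f x : ℝ) ^ 2)

/-- The angular coordinates of a point are dropped: the point is sent to its fixed part together
with its radii in the planes indexed by `I`. -/
def radialMap (e f : Fin n → Euc m) (I : Finset (Fin n)) (x : Euc m) : Euc m :=
  fixedPart e f x + ∑ i ∈ I, radius (e i) (f i) x • e i

/-- The logarithmic derivative of the radius. -/
def radialCoeff (e f x v : Euc m) : ℝ :=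
  ((inner ℝ e x : ℝ) * inner ℝ e v + (inner ℝ f x : ℝ) * inner ℝ f v) / radius e f x ^ 2

/-- The derivative of `radialMap` at `x`. -/
def radialDeriv (e f : Fin n → Euc m) (I : Finset (Fin n)) (x : Euc m) : Euc m →L[ℝ] Euc m :=
  fixedPart e f + ∑ i ∈ I, ((radius (e i) (f i) x)⁻¹ • ((inner ℝ (e i) x : ℝ) • innerSL ℝ (e i)
    + (inner ℝ (f i) x : ℝ) • innerSL ℝ (f i))).smulRight (e i)

theorem radius_sq (e f x : Euc m) :
    radius e f x ^ 2 = (inner ℝ e x : ℝ) ^ 2 + (inner ℝ f x : ℝ) ^ 2 :=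
  Real.sq_sqrt (by positivity)

theorem radialDeriv_apply {e f : Fin n → Euc m} {I : Finset (Fin n)} {x : Euc m}
    (hx : ∀ i ∈ I, radius (e i) (f i) x ≠ 0) (v : Euc m) :
    radialDeriv e f I x v = fixedPart e f v
      + ∑ i ∈ I, radialCoeff (e i) (f i) x v • (radius (e i) (f i) x • e i) := by
  simp only [radialDeriv, add_apply, sum_apply,
    ContinuousLinearMap.smulRight_apply, smul_apply, innerSL_apply_apply,
    smul_eq_mul, smul_smul]
  congr 1
  refine Finset.sum_congr rfl fun i hi => ?_
  have := hx i hi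
  congr 1
  rw [radialCoeff]
  field_simp

theorem hasFDerivAt_radius {e f x : Euc m} (hx : radius e f x ≠ 0) :
    HasFDerivAt (radius e f) ((radius e f x)⁻¹ • ((inner ℝ e x : ℝ) • innerSL ℝ e
      + (inner ℝ f x : ℝ) • innerSL ℝ f)) x := by
  have h1 : ∀ a : Euc m, HasFDerivAt (fun y => (inner ℝ a y : ℝ) ^ 2)
      ((2 * (inner ℝ a x : ℝ)) • innerSL ℝ a) x := by
    intro a
    have := ((innerSL ℝ a).hasFDerivAt (x := x)).pow 2
    simpa using this
  have h2 := ((h1 e).fun_add (h1 f)).sqrt (by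
    intro h0
    apply hx
    have h0' : (inner ℝ e x : ℝ) ^ 2 + (inner ℝ f x : ℝ) ^ 2 = 0 := h0
    rw [radius, h0', Real.sqrt_zero])
  have h3 : √((inner ℝ e x : ℝ) ^ 2 + (inner ℝ f x : ℝ) ^ 2) = radius e f x := rfl
  rw [h3] at h2
  have h4 : (radius e f x)⁻¹ • ((inner ℝ e x : ℝ) • innerSL ℝ e + (inner ℝ f x : ℝ) • innerSL ℝ f) =
      (1 / (2 * radius e f x)) • ((2 * (inner ℝ e x : ℝ)) • innerSL ℝ e
        + (2 * (inner ℝ f x : ℝ)) • innerSL ℝ f) := by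
    ext v
    simp
    field_simp
  rw [h4]
  exact h2

theorem hasFDerivAt_radialMap {e f : Fin n → Euc m} {I : Finset (Fin n)} {x : Euc m}
    (hx : ∀ i ∈ I, radius (e i) (f i) x ≠ 0) :
    HasFDerivAt (radialMap e f I) (radialDeriv e f I x) x :=
  (fixedPart e f).hasFDerivAt.add
    (HasFDerivAt.fun_sum fun i hi => (hasFDerivAt_radius (hx i hi)).smul_const (e i))

theorem contDiffAt_radialMap {e f : Fin n → Euc m} {I : Finset (Fin n)} {x : Euc m}
    (hx : ∀ i ∈ I, radius (e i) (f i) x ≠ 0) : ContDiffAt ℝ ∞ (radialMap e f I) x := by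
  refine (fixedPart e f).contDiff.contDiffAt.add (ContDiffAt.sum fun i hi => ?_)
  refine ContDiffAt.smul (ContDiffAt.sqrt ?_ ?_) contDiffAt_const
  · exact (((innerSL ℝ (e i)).contDiff.pow 2).add ((innerSL ℝ (f i)).contDiff.pow 2)).contDiffAt
  · intro h0
    exact hx i hi (by rw [radius, h0, Real.sqrt_zero])

theorem eq_iff_fixedPart_eq {e f : Fin n → Euc m} {x y : Euc m} :
    x = y ↔ fixedPart e f x = fixedPart e f y ∧
      ∀ i, inner ℝ (e i) x = (inner ℝ (e i) y : ℝ) ∧ inner ℝ (f i) x = (inner ℝ (f i) y : ℝ) := by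
  refine ⟨fun hxy => by simp [hxy], fun ⟨h0, h1⟩ => ?_⟩
  have : ∀ i, planeProj (e i) (f i) x = planeProj (e i) (f i) y := fun i => by
    rw [planeProj_apply, planeProj_apply, (h1 i).1, (h1 i).2]
  simpa [fixedPart_apply, this] using h0

theorem radius_eq_zero_iff {e f x : Euc m} :
    radius e f x = 0 ↔ inner ℝ e x = (0 : ℝ) ∧ inner ℝ f x = (0 : ℝ) := by
  rw [← sq_eq_zero_iff, radius_sq]
  constructor
  · intro h
    constructor <;> nlinarith [sq_nonneg (inner ℝ e x : ℝ), sq_nonneg (inner ℝ f x : ℝ)]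
  · rintro ⟨h1, h2⟩
    rw [h1, h2]
    simp

/-! ### The quotient metric in radial coordinates -/

namespace IsWeightBasis

variable {ρ : Torus k →* Orth m} {e f : Fin n → Euc m} {w : Fin n → Fin k → ℤ}

theorem inner_left_planeProj (h : IsWeightBasis ρ e f w) (i j : Fin n) (x : Euc m) :
    inner ℝ (e i) (planeProj (e j) (f j) x) = if i = j then (inner ℝ (e i) x : ℝ) else 0 := by
  rw [planeProj_apply, inner_add_right, inner_smul_right, inner_smul_right, h.inner_left_left,
    h.inner_left_right]
  split_ifs with hij
  · subst hij
    simp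
  · simp

theorem inner_right_planeProj (h : IsWeightBasis ρ e f w) (i j : Fin n) (x : Euc m) :
    inner ℝ (f i) (planeProj (e j) (f j) x) = if i = j then (inner ℝ (f i) x : ℝ) else 0 := by
  rw [planeProj_apply, inner_add_right, inner_smul_right, inner_smul_right, h.inner_right_left,
    h.inner_right_right]
  split_ifs with hij
  · subst hij
    simp
  · simp

theorem inner_left_rotField (h : IsWeightBasis ρ e f w) (i : Fin n) (c : Fin n → ℝ) (x : Euc m) :
    inner ℝ (e i) (rotField e f c x) = -(c i * inner ℝ (f i) x : ℝ) := by
  simp [rotField_apply, planeRot_apply, inner_sum, inner_smul_right, inner_sub_right,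
    h.inner_left_left, h.inner_left_right]

theorem inner_right_rotField (h : IsWeightBasis ρ e f w) (i : Fin n) (c : Fin n → ℝ) (x : Euc m) :
    inner ℝ (f i) (rotField e f c x) = (c i * inner ℝ (e i) x : ℝ) := by
  simp [rotField_apply, planeRot_apply, inner_sum, inner_smul_right, inner_sub_right,
    h.inner_right_left, h.inner_right_right]

theorem inner_left_fixedPart (h : IsWeightBasis ρ e f w) (i : Fin n) (x : Euc m) :
    inner ℝ (e i) (fixedPart e f x) = (0 : ℝ) := by
  simp [fixedPart_apply, inner_sub_right, inner_sum, h.inner_left_planeProj]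

theorem inner_right_fixedPart (h : IsWeightBasis ρ e f w) (i : Fin n) (x : Euc m) :
    inner ℝ (f i) (fixedPart e f x) = (0 : ℝ) := by
  simp [fixedPart_apply, inner_sub_right, inner_sum, h.inner_right_planeProj]

theorem fixedPart_left (h : IsWeightBasis ρ e f w) (i : Fin n) : fixedPart e f (e i) = 0 := by
  simp [fixedPart_apply, planeProj_apply, h.inner_left_left, h.inner_right_left, ite_smul]

theorem fixedPart_right (h : IsWeightBasis ρ e f w) (i : Fin n) : fixedPart e f (f i) = 0 := by
  simp [fixedPart_apply, planeProj_apply, h.inner_left_right, h.inner_right_right, ite_smul]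

theorem fixedPart_planeProj (h : IsWeightBasis ρ e f w) (i : Fin n) (x : Euc m) :
    fixedPart e f (planeProj (e i) (f i) x) = 0 := by
  simp [planeProj_apply, h.fixedPart_left, h.fixedPart_right]

theorem fixedPart_rotField (h : IsWeightBasis ρ e f w) (c : Fin n → ℝ) (x : Euc m) :
    fixedPart e f (rotField e f c x) = 0 := by
  simp [rotField_apply, planeRot_apply, h.fixedPart_left, h.fixedPart_right]

theorem fixedPart_fixedPart (h : IsWeightBasis ρ e f w) (x : Euc m) :
    fixedPart e f (fixedPart e f x) = fixedPart e f x := by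
  conv_lhs => rw [fixedPart_apply e f x, map_sub, map_sum]
  simp [h.fixedPart_planeProj]

theorem planeProj_eq_zero_iff (h : IsWeightBasis ρ e f w) {i : Fin n} {x : Euc m} :
    planeProj (e i) (f i) x = 0 ↔ radius (e i) (f i) x = 0 := by
  rw [radius_eq_zero_iff]
  constructor
  · intro h0
    have h1 := congrArg (inner ℝ (e i)) h0
    have h2 := congrArg (inner ℝ (f i)) h0
    rw [h.inner_left_planeProj, if_pos rfl, inner_zero_right] at h1
    rw [h.inner_right_planeProj, if_pos rfl, inner_zero_right] at h2
    exact ⟨h1, h2⟩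
  · rintro ⟨h1, h2⟩
    rw [planeProj_apply, h1, h2]
    simp

/-- Inner products of vectors whose components in the planes are multiples of given vectors. -/
theorem inner_add_sum (h : IsWeightBasis ρ e f w) (I : Finset (Fin n)) (v v' : Euc m)
    (a a' : Fin n → ℝ) {y : Fin n → Euc m} (hy : ∀ i, planeProj (e i) (f i) (y i) = y i) :
    inner ℝ (fixedPart e f v + ∑ i ∈ I, a i • y i) (fixedPart e f v' + ∑ i ∈ I, a' i • y i) =
      inner ℝ (fixedPart e f v) (fixedPart e f v')
        + ∑ i ∈ I, a i * a' i * radius (e i) (f i) (y i) ^ 2 := by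
  have h1 : ∀ i x, inner ℝ (y i) (fixedPart e f x) = (0 : ℝ) := by
    intro i x
    rw [← hy i, planeProj_apply, inner_add_left, inner_smul_left, inner_smul_left,
      h.inner_left_fixedPart, h.inner_right_fixedPart]
    simp
  have hey : ∀ i j, inner ℝ (e i) (y j) = if i = j then (inner ℝ (e i) (y i) : ℝ) else 0 := by
    intro i j
    conv_lhs => rw [← hy j, h.inner_left_planeProj]
    split_ifs with hij
    · rw [hij]
    · rfl
  have hfy : ∀ i j, inner ℝ (f i) (y j) = if i = j then (inner ℝ (f i) (y i) : ℝ) else 0 := by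
    intro i j
    conv_lhs => rw [← hy j, h.inner_right_planeProj]
    split_ifs with hij
    · rw [hij]
    · rfl
  have h2 : ∀ i j, inner ℝ (y i) (y j) = if i = j then radius (e i) (f i) (y i) ^ 2 else 0 := by
    intro i j
    have h3 : inner ℝ (y i) (y j) = (inner ℝ (planeProj (e i) (f i) (y i)) (y j) : ℝ) := by
      rw [hy i]
    rw [h3, planeProj_apply, inner_add_left, inner_smul_left, inner_smul_left, hey i j, hfy i j,
      radius_sq]
    split_ifs
    · simp [sq]
    · simp
  simp only [inner_add_left, inner_add_right, inner_sum, sum_inner, inner_smul_left,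
    inner_smul_right, h1, h2, real_inner_comm (y _) (fixedPart e f _), conj_trivial]
  simp only [mul_zero, Finset.sum_const_zero, add_zero, zero_add]
  congr 1
  refine Finset.sum_congr rfl fun i hi => ?_
  simp [hi]
  ring

/-- Vanishing of a component is inherited along the stratum, when there are dual coweights. -/
theorem planeProj_eq_zero_of_mem_fixedSpace (h : IsWeightBasis ρ e f w) (hD : HasDualCoweights w)
    {x v : Euc m} (hv : v ∈ fixedSpace ρ (isotropy ρ x)) {i : Fin n}
    (hi : planeProj (e i) (f i) x = 0) : planeProj (e i) (f i) v = 0 := by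
  obtain ⟨ξ, hξ, hξ'⟩ := hD i
  have hμ : weightPairing (w i) (fun a => (ξ a : ℝ)) ≠ 0 := by
    rw [weightPairing_intCast]
    exact_mod_cast hξ
  -- The coweight is scaled so that η makes a half turn in the i-th plane and acts trivially on the
  -- others. It then fixes x but no vector with a nonzero i-th component.
  set η : Fin k → ℝ := (Real.pi / weightPairing (w i) (fun a => (ξ a : ℝ))) • fun a => (ξ a : ℝ)
    with hη
  have hηi : weightPairing (w i) η = Real.pi := by
    rw [hη, weightPairing_smul, div_mul_cancel₀ _ hμ]
  have hx : torusExp η ∈ isotropy ρ x := by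
    change ρ (torusExp η) x = x
    rw [h.apply_eq_self_iff]
    intro j
    by_cases hj : j = i
    · exact Or.inl (hj ▸ hi)
    · right
      rw [hη, weightPairing_smul, weightPairing_intCast (w j), hξ' j hj]
      simp
  rcases (h.apply_eq_self_iff η v).1 (hv _ hx) i with h0 | h0
  · exact h0
  · rw [hηi, Real.cos_pi] at h0
    norm_num at h0

/-- A dual coweight scaled to unit speed generates the rotation of the i-th plane alone;
independence thus makes every angular direction vertical. -/
theorem planeRot_mem_verticalSpace (h : IsWeightBasis ρ e f w) (hD : HasDualCoweights w)
    (x : Euc m) (i : Fin n) : planeRot (e i) (f i) x ∈ verticalSpace ρ x := by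
  obtain ⟨ξ, hξ, hξ'⟩ := hD i
  have hμ : weightPairing (w i) (fun a => (ξ a : ℝ)) ≠ 0 := by
    rw [weightPairing_intCast]
    exact_mod_cast hξ
  rw [h.mem_verticalSpace]
  refine ⟨(weightPairing (w i) (fun a => (ξ a : ℝ)))⁻¹ • fun a => (ξ a : ℝ), ?_⟩
  rw [rotField_apply, Finset.sum_eq_single i]
  · rw [weightPairing_smul, inv_mul_cancel₀ hμ, one_smul]
  · intro j _ hj
    rw [weightPairing_smul, weightPairing_intCast (w j), hξ' j hj]
    simp
  · simp

/-- The horizontal projection, when there are dual coweights. -/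
theorem horizontalProj_eq (h : IsWeightBasis ρ e f w) (hD : HasDualCoweights w)
    {I : Finset (Fin n)} {x v : Euc m} (hx : ∀ i ∈ I, radius (e i) (f i) x ≠ 0)
    (hv : ∀ i ∉ I, planeProj (e i) (f i) v = 0) :
    horizontalProj ρ x v = fixedPart e f v
      + ∑ i ∈ I, radialCoeff (e i) (f i) x v • planeProj (e i) (f i) x := by
  have hsum : v = fixedPart e f v + ∑ i ∈ I, planeProj (e i) (f i) v := by
    rw [fixedPart_apply, Finset.sum_subset (Finset.subset_univ I) fun i _ hi => hv i hi]
    abel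
  refine Submodule.eq_starProjection_of_mem_of_inner_eq_zero
    (K := (verticalSpace ρ x)ᗮ) ?_ ?_
  · rw [Submodule.mem_orthogonal]
    intro y hy
    obtain ⟨ξ, rfl⟩ := h.mem_verticalSpace.1 hy
    rw [rotField_apply, sum_inner]
    refine Finset.sum_eq_zero fun i _ => ?_
    rw [inner_smul_left, planeRot_apply, inner_sub_left, inner_smul_left, inner_smul_left]
    simp only [inner_add_right, inner_sum, inner_smul_right, h.inner_left_fixedPart,
      h.inner_right_fixedPart, h.inner_left_planeProj, h.inner_right_planeProj, conj_trivial,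
      mul_ite, mul_zero, Finset.sum_ite_eq, zero_add]
    split_ifs
    · ring
    · ring
  · intro y hy
    -- What is removed from v is its angular part in each plane, and that is vertical.
    have hdiff : v - (fixedPart e f v
        + ∑ i ∈ I, radialCoeff (e i) (f i) x v • planeProj (e i) (f i) x) =
        ∑ i ∈ I, (((inner ℝ (e i) x : ℝ) * inner ℝ (f i) v - (inner ℝ (f i) x : ℝ) * inner ℝ (e i) v)
          / radius (e i) (f i) x ^ 2) • planeRot (e i) (f i) x := by
      rw [← sub_sub, sub_eq_iff_eq_add'.2 hsum, ← Finset.sum_sub_distrib]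
      refine Finset.sum_congr rfl fun i hi => ?_
      have hr := pow_ne_zero 2 (hx i hi)
      have hr2 := radius_sq (e i) (f i) x
      rw [planeProj_apply, planeProj_apply, planeRot_apply, radialCoeff]
      set p : ℝ := inner ℝ (e i) x
      set q : ℝ := inner ℝ (f i) x
      set p' : ℝ := inner ℝ (e i) v
      set q' : ℝ := inner ℝ (f i) v
      set R : ℝ := radius (e i) (f i) x ^ 2
      have h1 : p' - (p * p' + q * q') / R * p = -((p * q' - q * p') / R * q) := by
        field_simp
        rw [hr2]
        ring
      have h2 : q' - (p * p' + q * q') / R * q = (p * q' - q * p') / R * p := by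
        field_simp
        rw [hr2]
        ring
      calc _ = (p' - (p * p' + q * q') / R * p) • e i
            + (q' - (p * p' + q * q') / R * q) • f i := by module
        _ = _ := by
          rw [h1, h2]
          module
    rw [hdiff]
    rw [Submodule.mem_orthogonal] at hy
    refine hy _ (Submodule.sum_mem _ fun i _ => Submodule.smul_mem _ _ ?_)
    exact h.planeRot_mem_verticalSpace hD x i

/-- On both sides the i-th component is the same multiple, `radialCoeff`, of a vector of length
equal to the radius: the component of x on the left, the radius times e_i on the right. -/
theorem inner_horizontalProj (h : IsWeightBasis ρ e f w) (hD : HasDualCoweights w)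
    {I : Finset (Fin n)} {x v v' : Euc m} (hx : ∀ i ∈ I, radius (e i) (f i) x ≠ 0)
    (hv : ∀ i ∉ I, planeProj (e i) (f i) v = 0) (hv' : ∀ i ∉ I, planeProj (e i) (f i) v' = 0) :
    inner ℝ (horizontalProj ρ x v) (horizontalProj ρ x v') =
      (inner ℝ (radialDeriv e f I x v) (radialDeriv e f I x v') : ℝ) := by
  rw [h.horizontalProj_eq hD hx hv, h.horizontalProj_eq hD hx hv', radialDeriv_apply hx,
    radialDeriv_apply hx, h.inner_add_sum, h.inner_add_sum]
  · congr 1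
    refine Finset.sum_congr rfl fun i _ => ?_
    congr 1
    simp [radius_sq, h.inner_left_planeProj, h.inner_right_planeProj, inner_smul_right,
      h.inner_right_left, h.orthonormal_left.1 i]
  · intro i
    simp [planeProj_apply, h.inner_right_left, h.orthonormal_left.1 i]
  · intro i
    rw [planeProj_apply, h.inner_left_planeProj, h.inner_right_planeProj, if_pos rfl, if_pos rfl,
      planeProj_apply]

theorem inner_left_radialDeriv (h : IsWeightBasis ρ e f w) {I : Finset (Fin n)} {x : Euc m}
    (hx : ∀ i ∈ I, radius (e i) (f i) x ≠ 0) (i : Fin n) (v : Euc m) :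
    inner ℝ (e i) (radialDeriv e f I x v) =
      if i ∈ I then radialCoeff (e i) (f i) x v * radius (e i) (f i) x else 0 := by
  rw [radialDeriv_apply hx]
  simp [inner_add_right, inner_sum, inner_smul_right, h.inner_left_fixedPart, h.inner_left_left]

theorem inner_right_radialDeriv (h : IsWeightBasis ρ e f w) {I : Finset (Fin n)} {x : Euc m}
    (hx : ∀ i ∈ I, radius (e i) (f i) x ≠ 0) (i : Fin n) (v : Euc m) :
    inner ℝ (f i) (radialDeriv e f I x v) = (0 : ℝ) := by
  rw [radialDeriv_apply hx]
  simp [inner_add_right, inner_sum, inner_smul_right, h.inner_right_fixedPart, h.inner_right_left]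

theorem fixedPart_radialDeriv (h : IsWeightBasis ρ e f w) {I : Finset (Fin n)} {x : Euc m}
    (hx : ∀ i ∈ I, radius (e i) (f i) x ≠ 0) (v : Euc m) :
    fixedPart e f (radialDeriv e f I x v) = fixedPart e f v := by
  rw [radialDeriv_apply hx]
  simp [h.fixedPart_left, h.fixedPart_fixedPart]

theorem radialDeriv_of_mem_verticalSpace (h : IsWeightBasis ρ e f w) {I : Finset (Fin n)}
    {x v : Euc m} (hx : ∀ i ∈ I, radius (e i) (f i) x ≠ 0) (hv : v ∈ verticalSpace ρ x) :
    radialDeriv e f I x v = 0 := by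
  obtain ⟨ξ, rfl⟩ := h.mem_verticalSpace.1 hv
  rw [radialDeriv_apply hx, h.fixedPart_rotField, zero_add]
  refine Finset.sum_eq_zero fun i _ => ?_
  rw [radialCoeff, h.inner_left_rotField, h.inner_right_rotField]
  rw [show ∀ a b c : ℝ, a * -(c * b) + b * (c * a) = 0 from fun a b c => by ring]
  simp

/-- If there are dual coweights, all quotient strata are flat. -/
theorem riemannTensor_quotientMetric_eq_zero (h : IsWeightBasis ρ e f w) (hD : HasDualCoweights w)
    {H : Subgroup (Torus k)} {d : ℕ} {U : Set (Euc d)} {s : Euc d → Euc m}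
    (hs : IsLocalCoordinates ρ H U s) {u₀ : Euc d} (hu₀ : u₀ ∈ U) (i j p q : Fin d) :
    riemannTensor (quotientMetric ρ s) i j p q u₀ = 0 := by
  classical
  -- The planes in which s u₀ has a nonzero component. By independence the isotropy group determines
  -- this set, so it is the same over all of U.
  let I : Finset (Fin n) := Finset.univ.filter fun i => radius (e i) (f i) (s u₀) ≠ 0
  have hiso : ∀ u ∈ U, isotropy ρ (s u) = H := fun u hu => hs.mapsTo hu
  have hself : ∀ x : Euc m, x ∈ fixedSpace ρ (isotropy ρ x) := fun x t ht => ht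
  have hI : ∀ u ∈ U, ∀ i ∈ I, radius (e i) (f i) (s u) ≠ 0 := by
    intro u hu i hi h0
    refine (Finset.mem_filter.1 hi).2 (h.planeProj_eq_zero_iff.1 ?_)
    refine h.planeProj_eq_zero_of_mem_fixedSpace hD (x := s u) ?_ (h.planeProj_eq_zero_iff.2 h0)
    rw [hiso u hu, ← hiso u₀ hu₀]
    exact hself _
  have hfix : ∀ v ∈ fixedSpace ρ H, ∀ i ∉ I, planeProj (e i) (f i) v = 0 := by
    intro v hv i hi
    refine h.planeProj_eq_zero_of_mem_fixedSpace hD (x := s u₀) (by rwa [hiso u₀ hu₀]) ?_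
    rw [h.planeProj_eq_zero_iff]
    by_contra hne
    exact hi (Finset.mem_filter.2 ⟨Finset.mem_univ _, hne⟩)
  have hds : ∀ u ∈ U, ∀ a, fderiv ℝ s u a ∈ fixedSpace ρ H := by
    intro u hu a
    rw [← hs.span u hu]
    exact Submodule.mem_sup_left ⟨a, rfl⟩
  have hsd : ∀ u ∈ U, DifferentiableAt ℝ s u := fun u hu =>
    differentiableAt_of_contDiffOn hs.isOpen hs.smooth hu
  have hder : ∀ u ∈ U, fderiv ℝ (fun x => radialMap e f I (s x)) u =
      (radialDeriv e f I (s u)).comp (fderiv ℝ s u) := fun u hu =>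
    ((hasFDerivAt_radialMap (hI u hu)).comp u (hsd u hu).hasFDerivAt).fderiv
  have hinner : ∀ u ∈ U, ∀ a b,
      inner ℝ (horizontalProj ρ (s u) (fderiv ℝ s u a)) (horizontalProj ρ (s u) (fderiv ℝ s u b)) =
        (inner ℝ (radialDeriv e f I (s u) (fderiv ℝ s u a))
          (radialDeriv e f I (s u) (fderiv ℝ s u b)) : ℝ) := fun u hu a b =>
    h.inner_horizontalProj hD (hI u hu) (hfix _ (hds u hu a)) (hfix _ (hds u hu b))
  -- The common tangent space: the fixed vectors plus the span of the e_i with i in I.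
  let L : Submodule ℝ (Euc m) :=
    { carrier := {y | (∀ i, inner ℝ (f i) y = (0 : ℝ)) ∧ ∀ i ∉ I, inner ℝ (e i) y = (0 : ℝ)}
      zero_mem' := by simp
      add_mem' := by
        rintro a b ⟨ha, ha'⟩ ⟨hb, hb'⟩
        exact ⟨fun i => by rw [inner_add_right, ha, hb, add_zero],
          fun i hi => by rw [inner_add_right, ha' i hi, hb' i hi, add_zero]⟩
      smul_mem' := by
        rintro c a ⟨ha, ha'⟩
        exact ⟨fun i => by rw [inner_smul_right, ha, mul_zero],
          fun i hi => by rw [inner_smul_right, ha' i hi, mul_zero]⟩ }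
  refine riemannTensor_eq_zero_of_constant_range hs.isOpen
    (G := fun x => radialMap e f I (s x)) (L := L) ?_ ?_ ?_ ?_ hu₀ i j p q
  · intro u hu
    exact ((contDiffAt_radialMap (hI u hu)).comp u
      (hs.smooth.contDiffAt (hs.isOpen.mem_nhds hu))).contDiffWithinAt
  · intro u hu
    rw [hder u hu, injective_iff_map_eq_zero]
    intro a ha
    rw [ContinuousLinearMap.comp_apply] at ha
    -- A coordinate vector killed by the radial derivative has zero horizontal part, so its lift is
    -- vertical; transversality to the orbits makes the lift zero.
    have h0 := hinner u hu a a
    rw [ha, inner_zero_left, inner_self_eq_zero, horizontalProj,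
      Submodule.starProjection_apply_eq_zero_iff, Submodule.orthogonal_orthogonal] at h0
    have h1 := (Submodule.disjoint_def.1 (hs.disjoint u hu)) _ ⟨a, rfl⟩ h0
    exact hs.immersion u hu (h1.trans (map_zero _).symm)
  · intro u hu
    rw [hder u hu]
    ext y
    constructor
    · rintro ⟨a, rfl⟩
      refine ⟨fun i => h.inner_right_radialDeriv (hI u hu) i _, fun i hi => ?_⟩
      exact (h.inner_left_radialDeriv (hI u hu) i _).trans (if_neg hi)
    · rintro ⟨hy, hy'⟩
      -- The lift of y replaces each e_i by the unit radial direction at s u. It is tangent to the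
      -- stratum, and its vertical component is invisible to the radial derivative.
      set v : Euc m := fixedPart e f y + ∑ i ∈ I,
        ((inner ℝ (e i) y : ℝ) / radius (e i) (f i) (s u)) • planeProj (e i) (f i) (s u) with hv
      have hve : ∀ i, inner ℝ (e i) v = if i ∈ I then
          (inner ℝ (e i) y : ℝ) / radius (e i) (f i) (s u) * inner ℝ (e i) (s u) else 0 := by
        intro i
        simp [hv, inner_add_right, inner_sum, inner_smul_right, h.inner_left_fixedPart,
          h.inner_left_planeProj]
      have hvf : ∀ i, inner ℝ (f i) v = if i ∈ I then
          (inner ℝ (e i) y : ℝ) / radius (e i) (f i) (s u) * inner ℝ (f i) (s u) else 0 := by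
        intro i
        simp [hv, inner_add_right, inner_sum, inner_smul_right, h.inner_right_fixedPart,
          h.inner_right_planeProj]
      have hv0 : fixedPart e f v = fixedPart e f y := by
        simp [hv, h.fixedPart_fixedPart, h.fixedPart_planeProj]
      have hvH : v ∈ fixedSpace ρ H := by
        intro t ht
        obtain ⟨ξ, rfl⟩ := torusExp_surjective t
        rw [h.apply_eq_self_iff]
        intro i
        by_cases hi : i ∈ I
        · right
          rw [← hiso u hu] at ht
          refine ((h.apply_eq_self_iff ξ (s u)).1 ht i).resolve_left ?_
          rw [h.planeProj_eq_zero_iff]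
          exact hI u hu i hi
        · left
          simp [planeProj_apply, hve, hvf, hi]
      rw [← hs.span u hu] at hvH
      obtain ⟨_, ⟨a, rfl⟩, z, hz, haz⟩ := Submodule.mem_sup.1 hvH
      refine ⟨a, ?_⟩
      change radialDeriv e f I (s u) (fderiv ℝ s u a) = y
      have h1 : radialDeriv e f I (s u) (fderiv ℝ s u a) = radialDeriv e f I (s u) v := by
        rw [← haz, map_add, h.radialDeriv_of_mem_verticalSpace (hI u hu) hz, add_zero]
        rfl
      rw [h1, eq_iff_fixedPart_eq (e := e) (f := f)]
      refine ⟨by rw [h.fixedPart_radialDeriv (hI u hu), hv0], fun i => ⟨?_, ?_⟩⟩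
      · rw [h.inner_left_radialDeriv (hI u hu)]
        split_ifs with hi
        · have hr := hI u hu i hi
          have hr2 := radius_sq (e i) (f i) (s u)
          rw [radialCoeff, hve, hvf, if_pos hi, if_pos hi]
          field_simp
          rw [hr2]
        · exact (hy' i hi).symm
      · rw [h.inner_right_radialDeriv (hI u hu), hy]
  · intro u hu i j
    rw [quotientMetric, Matrix.of_apply, hinner u hu, partialDeriv, partialDeriv, hder u hu]
    rfl

end IsWeightBasis

/-- The quotient metric is the inner product of the horizontal parts of the lifts. -/
theorem metricInner_quotientMetric (ρ : Torus k →* Orth m) {d : ℕ} (s : Euc d → Euc m)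
    (u a b : Euc d) : metricInner (quotientMetric ρ s) u a b =
      inner ℝ (horizontalProj ρ (s u) (fderiv ℝ s u a))
        (horizontalProj ρ (s u) (fderiv ℝ s u b)) := by
  have hb : ∀ v : Euc m, inner ℝ v (horizontalProj ρ (s u) (fderiv ℝ s u b)) =
      ∑ j, b j * (inner ℝ v (horizontalProj ρ (s u) (fderiv ℝ s u (basisVec j))) : ℝ) := by
    intro v
    conv_lhs => rw [← sum_smul_basisVec b]
    simp only [map_sum, map_smul, inner_sum, inner_smul_right]
  conv_rhs => rw [← sum_smul_basisVec a]
  simp only [map_sum, map_smul, sum_inner, inner_smul_left, conj_trivial, hb, metricInner,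
    quotientMetric, Matrix.of_apply, Finset.mul_sum]
  rw [Finset.sum_comm]
  exact Finset.sum_congr rfl fun i _ => Finset.sum_congr rfl fun j _ => by ring

/-- The curvature vanishes, so any positive constant would do; Cauchy–Schwarz makes the right side
of the bound nonnegative even for dependent vectors. -/
theorem IsWeightBasis.hasUniformlyBoundedStratifiedCurvature {ρ : Torus k →* Orth m}
    {e f : Fin n → Euc m} {w : Fin n → Fin k → ℤ} (h : IsWeightBasis ρ e f w)
    (hD : HasDualCoweights w) : HasUniformlyBoundedStratifiedCurvature ρ := by
  refine ⟨1, one_pos, fun H d U s hs u hu _ a b => ?_⟩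
  simp only [curvatureForm, h.riemannTensor_quotientMetric_eq_zero hD hs hu, zero_mul,
    Finset.sum_const_zero, abs_zero, metricInner_quotientMetric, one_mul]
  have := real_inner_mul_inner_self_le (horizontalProj ρ (s u) (fderiv ℝ s u a))
    (horizontalProj ρ (s u) (fderiv ℝ s u b))
  rw [sq]
  linarith

/-! ### The curvature at a point where the metric is Euclidean to first order -/

section Curvature

variable {d : ℕ}

theorem pderiv_mul_clm_mul_clm {N : Euc d → ℝ} (β γ : Euc d →L[ℝ] ℝ) {u : Euc d}
    (hN : DifferentiableAt ℝ N u) (k : Fin d) :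
    pderiv k (fun v => N v * β v * γ v) u =
      pderiv k N u * β u * γ u + N u * β (basisVec k) * γ u + N u * β u * γ (basisVec k) := by
  have h := (hN.hasFDerivAt.fun_mul (β.hasFDerivAt (x := u))).fun_mul (γ.hasFDerivAt (x := u))
  rw [pderiv, h.fderiv, pderiv]
  simp
  ring

theorem differentiableAt_pderiv {N : Euc d → ℝ} {u : Euc d} (hN : ContDiffAt ℝ ∞ N u)
    (k : Fin d) : DifferentiableAt ℝ (pderiv k N) u := by
  have h1 : ContDiffAt ℝ ∞ (fderiv ℝ N) u := hN.fderiv_right (by simp)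
  exact (h1.clm_apply contDiffAt_const).differentiableAt (by simp)

theorem eventually_differentiableAt {N : Euc d → ℝ} {u : Euc d} (hN : ContDiffAt ℝ ∞ N u) :
    ∀ᶠ v in 𝓝 u, DifferentiableAt ℝ N v := by
  have h1 : ContDiffAt ℝ 1 N u := hN.of_le (by exact_mod_cast le_top)
  filter_upwards [h1.eventually (by simp)] with v hv using hv.differentiableAt (by simp)

theorem pderiv_mul {A B : Euc d → ℝ} {u : Euc d} (hA : DifferentiableAt ℝ A u)
    (hB : DifferentiableAt ℝ B u) (k : Fin d) :
    pderiv k (fun v => A v * B v) u = pderiv k A u * B u + A u * pderiv k B u := by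
  rw [pderiv, (hA.hasFDerivAt.fun_mul hB.hasFDerivAt).fderiv]
  simp [pderiv]
  ring

theorem pderiv_sum {ι : Type*} {s : Finset ι} {A : ι → Euc d → ℝ} {u : Euc d}
    (hA : ∀ i ∈ s, DifferentiableAt ℝ (A i) u) (k : Fin d) :
    pderiv k (fun v => ∑ i ∈ s, A i v) u = ∑ i ∈ s, pderiv k (A i) u := by
  rw [pderiv, fderiv_fun_sum hA]
  simp [pderiv]

theorem pderiv_congr {A B : Euc d → ℝ} {u : Euc d} (h : A =ᶠ[𝓝 u] B) (k : Fin d) :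
    pderiv k A u = pderiv k B u := by
  rw [pderiv, h.fderiv_eq, pderiv]

theorem pderiv_add {A B : Euc d → ℝ} {u : Euc d} (hA : DifferentiableAt ℝ A u)
    (hB : DifferentiableAt ℝ B u) (k : Fin d) :
    pderiv k (fun v => A v + B v) u = pderiv k A u + pderiv k B u := by
  rw [pderiv, fderiv_fun_add hA hB]
  rfl

theorem pderiv_sub {A B : Euc d → ℝ} {u : Euc d} (hA : DifferentiableAt ℝ A u)
    (hB : DifferentiableAt ℝ B u) (k : Fin d) :
    pderiv k (fun v => A v - B v) u = pderiv k A u - pderiv k B u := by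
  rw [pderiv, fderiv_fun_sub hA hB]
  rfl

/-- Both linear forms vanish at 0, so only the terms that differentiate each of them once survive,
and the derivatives of N play no role. -/
theorem pderiv_pderiv_mul_clm_mul_clm {N : Euc d → ℝ} (β γ : Euc d →L[ℝ] ℝ)
    (hN : ContDiffAt ℝ ∞ N 0) (k l : Fin d) :
    pderiv l (pderiv k (fun v => N v * β v * γ v)) 0 =
      N 0 * (β (basisVec k) * γ (basisVec l) + β (basisVec l) * γ (basisVec k)) := by
  have h1 : pderiv k (fun v => N v * β v * γ v) =ᶠ[𝓝 0] fun u =>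
      pderiv k N u * β u * γ u + (N u * β (basisVec k) * γ u + N u * γ (basisVec k) * β u) := by
    filter_upwards [eventually_differentiableAt hN] with u hu
    rw [pderiv_mul_clm_mul_clm β γ hu]
    ring
  have hN' := hN.differentiableAt (by simp)
  have hk := differentiableAt_pderiv hN k
  have hβ : DifferentiableAt ℝ β (0 : Euc d) := β.differentiableAt
  have hγ : DifferentiableAt ℝ γ (0 : Euc d) := γ.differentiableAt
  have hclm : ∀ (δ : Euc d →L[ℝ] ℝ), pderiv l δ 0 = δ (basisVec l) := fun δ => by
    rw [pderiv, δ.fderiv]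
  rw [pderiv_congr h1, pderiv_add ((hk.fun_mul hβ).fun_mul hγ)
    (((hN'.mul_const _).fun_mul hγ).fun_add ((hN'.mul_const _).fun_mul hβ)),
    pderiv_mul_clm_mul_clm β γ hk,
    pderiv_add ((hN'.mul_const _).fun_mul hγ) ((hN'.mul_const _).fun_mul hβ),
    pderiv_mul (hN'.mul_const _) hγ, pderiv_mul (hN'.mul_const _) hβ, hclm, hclm]
  simp only [map_zero, mul_zero, add_zero, zero_add]
  ring

theorem sum_curvature_add (x y : Euc d) (R R' : Fin d → Fin d → Fin d → Fin d → ℝ) :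
    ∑ i, ∑ j, ∑ k, ∑ l, (R i j k l + R' i j k l) * x i * y j * y k * x l =
      ∑ i, ∑ j, ∑ k, ∑ l, R i j k l * x i * y j * y k * x l
        + ∑ i, ∑ j, ∑ k, ∑ l, R' i j k l * x i * y j * y k * x l := by
  simp only [add_mul, Finset.sum_add_distrib]

/-- With T = τ(x, y), the first term contributes τ(y, y) τ(x, x) = 0, the second -T τ(y, x) = T²,
and the third -2T τ(y, x) = 2T². -/
theorem sum_curvature_of_skew (x y : Euc d) {τ : Fin d → Fin d → ℝ}
    (hτ : ∀ i j, τ i j = -τ j i) :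
    ∑ i, ∑ j, ∑ k, ∑ l, (τ j k * τ i l - τ i k * τ j l - 2 * τ i j * τ k l)
        * x i * y j * y k * x l =
      3 * (∑ i, ∑ j, x i * y j * τ i j) ^ 2 := by
  have hskew : ∀ z z' : Euc d, ∑ i, ∑ j, z i * z' j * τ i j = -∑ i, ∑ j, z' i * z j * τ i j := by
    intro z z'
    rw [Finset.sum_comm, ← Finset.sum_neg_distrib]
    refine Finset.sum_congr rfl fun i _ => ?_
    rw [← Finset.sum_neg_distrib]
    refine Finset.sum_congr rfl fun j _ => ?_
    rw [hτ j i]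
    ring
  have hxx : ∑ i, ∑ j, x i * x j * τ i j = 0 := by linarith [hskew x x]
  have h1 : ∑ i, ∑ j, ∑ k, ∑ l, (y j * y k * τ j k) * (x i * x l * τ i l) = 0 := by
    have : ∀ i, ∑ j, ∑ k, ∑ l, (y j * y k * τ j k) * (x i * x l * τ i l) =
        (∑ j, ∑ k, y j * y k * τ j k) * ∑ l, x i * x l * τ i l := by
      intro i
      simp only [← Finset.mul_sum, ← Finset.sum_mul]
    rw [Finset.sum_congr rfl fun i _ => this i, ← Finset.mul_sum, hxx, mul_zero]
  have h3 : ∑ i, ∑ j, ∑ k, ∑ l, (x i * y j * τ i j) * (y k * x l * τ k l) =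
      (∑ i, ∑ j, x i * y j * τ i j) * ∑ k, ∑ l, y k * x l * τ k l := by
    simp only [← Finset.mul_sum, ← Finset.sum_mul]
  have h2 : ∑ i, ∑ j, ∑ k, ∑ l, (x i * y k * τ i k) * (y j * x l * τ j l) =
      (∑ i, ∑ j, x i * y j * τ i j) * ∑ k, ∑ l, y k * x l * τ k l := by
    rw [← h3]
    exact Finset.sum_congr rfl fun i _ => Finset.sum_comm
  have hsplit : ∑ i, ∑ j, ∑ k, ∑ l, (τ j k * τ i l - τ i k * τ j l - 2 * τ i j * τ k l)
        * x i * y j * y k * x l =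
      ∑ i, ∑ j, ∑ k, ∑ l, (y j * y k * τ j k) * (x i * x l * τ i l)
        - ∑ i, ∑ j, ∑ k, ∑ l, (x i * y k * τ i k) * (y j * x l * τ j l)
        - 2 * ∑ i, ∑ j, ∑ k, ∑ l, (x i * y j * τ i j) * (y k * x l * τ k l) := by
    simp only [Finset.mul_sum, ← Finset.sum_sub_distrib]
    refine Finset.sum_congr rfl fun i _ => Finset.sum_congr rfl fun j _ =>
      Finset.sum_congr rfl fun k _ => Finset.sum_congr rfl fun l _ => ?_
    ring
  rw [hsplit, h1, h2, h3, hskew y x]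
  ring

variable {r : ℕ} {g : Euc d → Matrix (Fin d) (Fin d) ℝ} {N : Fin r → Fin r → Euc d → ℝ}
  {β : Fin r → Fin d → Euc d →L[ℝ] ℝ}

/-- O'Neill's formula in coordinates: the curvature at `0` of a metric that differs from the
Euclidean one by a quadratic expression in skew linear forms. -/
theorem curvatureForm_eq_of_skew (hN : ∀ a b, ContDiffAt ℝ ∞ (N a b) 0)
    (hN0 : ∀ a b, N a b 0 = if a = b then 1 else 0)
    (hβ : ∀ a i j, β a i (basisVec j) = -β a j (basisVec i))
    (hg : ∀ᶠ u in 𝓝 0, ∀ i j, g u i j =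
      (if i = j then 1 else 0) - ∑ a, ∑ b, N a b u * β a i u * β b j u) (x y : Euc d) :
    curvatureForm g 0 x y = 3 * ∑ a, (∑ i, ∑ j, x i * y j * β a j (basisVec i)) ^ 2 := by
  have hg' : ∀ i j, (fun u => g u i j) =ᶠ[𝓝 0]
      fun u => (if i = j then 1 else 0) - ∑ a, ∑ b, N a b u * β a i u * β b j u := by
    intro i j
    filter_upwards [hg] with u hu using hu i j
  have hterm : ∀ a b i j, ContDiffAt ℝ ∞ (fun u => N a b u * β a i u * β b j u) 0 :=
    fun a b i j => ((hN a b).mul (β a i).contDiff.contDiffAt).mul (β b j).contDiff.contDiffAt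
  have hgc : ∀ i j, ContDiffAt ℝ ∞ (fun u => g u i j) 0 := fun i j =>
    (contDiffAt_const.sub (ContDiffAt.sum fun a _ => ContDiffAt.sum fun b _ =>
      hterm a b i j)).congr_of_eventuallyEq (hg' i j)
  have hpd : ∀ k i j, pderiv k (fun u => g u i j) =ᶠ[𝓝 0]
      fun u => -∑ a, ∑ b, pderiv k (fun v => N a b v * β a i v * β b j v) u := by
    intro k i j
    have hdiff : ∀ᶠ u in 𝓝 (0 : Euc d), ∀ a b,
        DifferentiableAt ℝ (fun v => N a b v * β a i v * β b j v) u := by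
      simp only [Filter.eventually_all]
      exact fun a b => eventually_differentiableAt (hterm a b i j)
    filter_upwards [(hg' i j).eventuallyEq_nhds, hdiff] with u hu hdu
    rw [pderiv_congr hu, pderiv_sub (differentiableAt_const _)
      (DifferentiableAt.fun_sum fun a _ => DifferentiableAt.fun_sum fun b _ => hdu a b),
      pderiv_sum fun a _ => DifferentiableAt.fun_sum fun b _ => hdu a b]
    rw [Finset.sum_congr rfl fun a _ => pderiv_sum (fun b _ => hdu a b) k]
    simp [pderiv]
  -- The perturbation is quadratic, so the first derivatives of g and the Christoffel symbols vanish
  -- at 0. Only second derivatives of g enter the curvature there.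
  have hpd0 : ∀ k i j, pderiv k (fun u => g u i j) 0 = 0 := by
    intro k i j
    rw [(hpd k i j).eq_of_nhds, neg_eq_zero]
    refine Finset.sum_eq_zero fun a _ => Finset.sum_eq_zero fun b _ => ?_
    rw [pderiv_mul_clm_mul_clm _ _ ((hN a b).differentiableAt (by simp))]
    simp
  have hpdd : ∀ k i j, DifferentiableAt ℝ (pderiv k (fun u => g u i j)) 0 := fun k i j =>
    differentiableAt_pderiv (hgc i j) k
  have hsecond : ∀ l k i j, pderiv l (pderiv k (fun u => g u i j)) 0 =
      -∑ a, (β a i (basisVec k) * β a j (basisVec l) + β a i (basisVec l) * β a j (basisVec k)) := by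
    intro l k i j
    have hd : ∀ a b, DifferentiableAt ℝ (pderiv k (fun v => N a b v * β a i v * β b j v)) 0 :=
      fun a b => differentiableAt_pderiv (hterm a b i j) k
    have h1 : pderiv l (fun u => -∑ a, ∑ b, pderiv k (fun v => N a b v * β a i v * β b j v) u) 0 =
        -∑ a, ∑ b, pderiv l (pderiv k (fun v => N a b v * β a i v * β b j v)) 0 := by
      rw [pderiv, fderiv_fun_neg]
      change -pderiv l _ 0 = _
      rw [pderiv_sum fun a _ => DifferentiableAt.fun_sum fun b _ => hd a b]
      rw [Finset.sum_congr rfl fun a _ => pderiv_sum (fun b _ => hd a b) l]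
    rw [pderiv_congr (hpd k i j), h1]
    congr 1
    refine Finset.sum_congr rfl fun a _ => ?_
    simp only [pderiv_pderiv_mul_clm_mul_clm _ _ (hN _ _), hN0]
    simp
  have hone : g 0 = 1 := by
    ext i j
    rw [(hg' i j).eq_of_nhds]
    simp [Matrix.one_apply]
  have hinv : ∀ p l, DifferentiableAt ℝ (fun u => (g u)⁻¹ p l) 0 := fun p l =>
    (contDiffAt_matrix_inv hgc (by simp [hone]) p l).differentiableAt (by simp)
  have hB : ∀ i j l, DifferentiableAt ℝ (fun u => pderiv i (fun x => g x j l) u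
      + pderiv j (fun x => g x i l) u - pderiv l (fun x => g x i j) u) 0 := fun i j l =>
    ((hpdd _ _ _).add (hpdd _ _ _)).sub (hpdd _ _ _)
  have hΓ0 : ∀ p i j, christoffel g p i j 0 = 0 := by
    intro p i j
    simp [christoffel, hpd0]
  have hΓ : ∀ c p i j, pderiv c (christoffel g p i j) 0 = (1 / 2 : ℝ) *
      (pderiv c (pderiv i (fun x => g x j p)) 0 + pderiv c (pderiv j (fun x => g x i p)) 0
        - pderiv c (pderiv p (fun x => g x i j)) 0) := by
    intro c p i j
    have hconst := pderiv_mul (u := 0) (differentiableAt_const (1 / 2 : ℝ))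
      (DifferentiableAt.fun_sum fun l (_ : l ∈ Finset.univ) => (hinv p l).fun_mul (hB i j l)) c
    change pderiv c (fun u => (1 / 2 : ℝ) * ∑ l, (g u)⁻¹ p l *
      (pderiv i (fun x => g x j l) u + pderiv j (fun x => g x i l) u
        - pderiv l (fun x => g x i j) u)) 0 = _
    rw [hconst, pderiv_sum fun l _ => (hinv p l).fun_mul (hB i j l)]
    rw [Finset.sum_congr rfl fun l _ => pderiv_mul (hinv p l) (hB i j l) c]
    have h0 : pderiv c (fun _ : Euc d => (1 / 2 : ℝ)) 0 = 0 := by simp [pderiv]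
    simp only [h0, hpd0, hone, inv_one, Matrix.one_apply, add_zero, sub_zero, mul_zero, zero_mul,
      zero_add, ite_mul, one_mul, Finset.sum_ite_eq, Finset.mem_univ, if_true]
    rw [pderiv_sub ((hpdd _ _ _).fun_add (hpdd _ _ _)) (hpdd _ _ _),
      pderiv_add (hpdd _ _ _) (hpdd _ _ _)]
  have hR : ∀ i j k l, riemannTensor g i j k l 0 = ∑ a,
      (β a k (basisVec j) * β a l (basisVec i) - β a k (basisVec i) * β a l (basisVec j)
        - 2 * β a j (basisVec i) * β a l (basisVec k)) := by
    intro i j k l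
    simp only [riemannTensor, hΓ0, hΓ, hone, Matrix.one_apply, ite_mul, one_mul, zero_mul, mul_zero,
      sub_zero, Finset.sum_const_zero, add_zero, Finset.sum_ite_eq', Finset.mem_univ, if_true,
      hsecond]
    simp only [← Finset.sum_neg_distrib, ← Finset.sum_add_distrib, ← Finset.sum_sub_distrib,
      Finset.mul_sum]
    refine Finset.sum_congr rfl fun a _ => ?_
    rw [hβ a i j, hβ a j k, hβ a l j, hβ a i l, hβ a i k, hβ a k l]
    ring
  have hsum : ∀ s : Finset (Fin r), ∑ i, ∑ j, ∑ k, ∑ l, (∑ a ∈ s,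
      (β a k (basisVec j) * β a l (basisVec i) - β a k (basisVec i) * β a l (basisVec j)
        - 2 * β a j (basisVec i) * β a l (basisVec k))) * x i * y j * y k * x l =
      ∑ a ∈ s, 3 * (∑ i, ∑ j, x i * y j * β a j (basisVec i)) ^ 2 := by
    intro s
    induction s using Finset.induction_on with
    | empty => simp
    | insert a s ha ih =>
      rw [Finset.sum_insert ha, ← ih, ← sum_curvature_of_skew x y
        (τ := fun i j => β a j (basisVec i)) (fun i j => hβ a j i), ← sum_curvature_add]
      simp only [Finset.sum_insert ha]
  simp only [curvatureForm, hR]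
  rw [hsum, Finset.mul_sum]

end Curvature

/-! ### Curvature of the principal stratum -/

/-- The infinitesimal action of the Lie algebra element `ξ`. -/
def killingField (e f : Fin n → Euc m) (w : Fin n → Fin k → ℤ) (ξ : Fin k → ℝ) :
    Euc m →L[ℝ] Euc m :=
  rotField e f fun i => weightPairing (w i) ξ

theorem inner_killingField_left (e f : Fin n → Euc m) (w : Fin n → Fin k → ℤ) (ξ : Fin k → ℝ)
    (x y : Euc m) :
    inner ℝ (killingField e f w ξ x) y = -(inner ℝ x (killingField e f w ξ y) : ℝ) := by
  simp only [killingField, rotField_apply, sum_inner, inner_sum, ← Finset.sum_neg_distrib]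
  refine Finset.sum_congr rfl fun i _ => ?_
  simp only [planeRot_apply, inner_smul_left, inner_smul_right, inner_sub_left, inner_sub_right,
    conj_trivial]
  rw [real_inner_comm (e i) x, real_inner_comm (f i) x]
  ring

namespace IsWeightBasis

variable {ρ : Torus k →* Orth m} {e f : Fin n → Euc m} {w : Fin n → Fin k → ℤ}

/-- At all points with nonvanishing components in all planes, the Killing fields satisfy the same
linear relations. -/
theorem killingField_eq_sum (h : IsWeightBasis ρ e f w) {x₀ : Euc m}
    (hx₀ : ∀ i, radius (e i) (f i) x₀ ≠ 0) {r : ℕ} {κ : Fin r → ℝ} {η : Fin r → Fin k → ℝ}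
    {ξ : Fin k → ℝ} (hξ : killingField e f w ξ x₀ = ∑ a, κ a • killingField e f w (η a) x₀) :
    (∀ i, weightPairing (w i) ξ = ∑ a, κ a * weightPairing (w i) (η a)) ∧
      ∀ x, killingField e f w ξ x = ∑ a, κ a • killingField e f w (η a) x := by
  have h1 : ∀ i, weightPairing (w i) ξ = ∑ a, κ a * weightPairing (w i) (η a) := by
    intro i
    have h2 := congrArg (inner ℝ (e i)) hξ
    have h3 := congrArg (inner ℝ (f i)) hξ
    simp only [killingField, inner_sum, inner_smul_right, h.inner_left_rotField,
      h.inner_right_rotField] at h2 h3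
    have h4 : (weightPairing (w i) ξ - ∑ a, κ a * weightPairing (w i) (η a))
        * (inner ℝ (f i) x₀ : ℝ) = 0 := by
      rw [sub_mul, Finset.sum_mul, sub_eq_zero, ← neg_inj, h2, ← Finset.sum_neg_distrib]
      exact Finset.sum_congr rfl fun a _ => by ring
    have h5 : (weightPairing (w i) ξ - ∑ a, κ a * weightPairing (w i) (η a))
        * (inner ℝ (e i) x₀ : ℝ) = 0 := by
      rw [sub_mul, Finset.sum_mul, sub_eq_zero, h3]
      exact Finset.sum_congr rfl fun a _ => by ring
    by_contra hne
    exact hx₀ i (radius_eq_zero_iff.2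
      ⟨(mul_eq_zero.1 h5).resolve_left (sub_ne_zero.2 hne),
        (mul_eq_zero.1 h4).resolve_left (sub_ne_zero.2 hne)⟩)
  refine ⟨h1, fun x => ?_⟩
  simp only [killingField, rotField_apply, h1, Finset.sum_smul, Finset.smul_sum, smul_smul]
  rw [Finset.sum_comm]

theorem isotropy_eq_of_radius_ne_zero (h : IsWeightBasis ρ e f w) {x y : Euc m}
    (hx : ∀ i, radius (e i) (f i) x ≠ 0) (hy : ∀ i, radius (e i) (f i) y ≠ 0) :
    isotropy ρ x = isotropy ρ y := by
  ext t
  obtain ⟨ξ, rfl⟩ := torusExp_surjective t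
  change ρ (torusExp ξ) x = x ↔ ρ (torusExp ξ) y = y
  rw [h.apply_eq_self_iff, h.apply_eq_self_iff]
  simp only [h.planeProj_eq_zero_iff, hx, hy, false_or]

theorem fixedSpace_eq_top (h : IsWeightBasis ρ e f w) {x : Euc m}
    (hx : ∀ i, radius (e i) (f i) x ≠ 0) : fixedSpace ρ (isotropy ρ x) = ⊤ := by
  rw [eq_top_iff]
  intro v _ t ht
  obtain ⟨ξ, rfl⟩ := torusExp_surjective t
  rw [h.apply_eq_self_iff]
  intro i
  refine Or.inr (((h.apply_eq_self_iff ξ x).1 ht i).resolve_left ?_)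
  rw [h.planeProj_eq_zero_iff]
  exact hx i

variable {d r : ℕ} {x₀ : Euc m} {η : Fin r → Fin k → ℝ} {L : Euc d →ₗᵢ[ℝ] Euc m}

theorem killingField_mem_verticalSpace (h : IsWeightBasis ρ e f w) (ξ : Fin k → ℝ) (x : Euc m) :
    killingField e f w ξ x ∈ verticalSpace ρ x :=
  h.mem_verticalSpace.2 ⟨ξ, rfl⟩

/-- An affine slice through a point of the principal stratum gives local coordinates. -/
theorem exists_isLocalCoordinates (h : IsWeightBasis ρ e f w)
    (hx₀ : ∀ i, radius (e i) (f i) x₀ ≠ 0)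
    (hη : ∀ a b, inner ℝ (killingField e f w (η a) x₀) (killingField e f w (η b) x₀) =
      if a = b then (1 : ℝ) else 0)
    (hspan : ∀ ξ, ∃ κ : Fin r → ℝ,
      killingField e f w ξ x₀ = ∑ a, κ a • killingField e f w (η a) x₀)
    (hL : LinearMap.range L.toLinearMap = (verticalSpace ρ x₀)ᗮ) :
    ∃ U : Set (Euc d), 0 ∈ U ∧
      IsLocalCoordinates ρ (isotropy ρ x₀) U (fun u => x₀ + L u) := by
  -- B pairs the Killing fields at the moving point with those at x₀ and is the identity at u = 0.
  -- Where it is invertible, the orbit directions are transverse to the slice and together with it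
  -- span everything; the radius condition keeps the point in the principal stratum.
  let B : Euc d → Matrix (Fin r) (Fin r) ℝ := fun u => Matrix.of fun a b =>
    inner ℝ (killingField e f w (η a) (x₀ + L u)) (killingField e f w (η b) x₀)
  have hB0 : B 0 = 1 := by
    ext a b
    simp [B, hη, Matrix.one_apply]
  have hder : ∀ u, HasFDerivAt (fun u => x₀ + L u) L.toContinuousLinearMap u := fun u =>
    L.toContinuousLinearMap.hasFDerivAt.const_add x₀
  have hcont : Continuous fun u => x₀ + L u := by fun_prop
  have hBcont : Continuous B := by
    refine continuous_matrix fun a b => ?_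
    exact ((killingField e f w (η a)).continuous.comp hcont).inner continuous_const
  have hrad : ∀ i, Continuous fun u => radius (e i) (f i) (x₀ + L u) := by
    intro i
    unfold radius
    fun_prop
  refine ⟨{u | (B u).det ≠ 0 ∧ ∀ i, radius (e i) (f i) (x₀ + L u) ≠ 0}, ?_, ?_, ?_, ?_, ?_, ?_, ?_⟩
  · refine ⟨by rw [hB0]; simp, fun i => by simpa using hx₀ i⟩
  · simp only [Set.ofPred_and, Set.ofPred_forall]
    exact (isOpen_ne_fun hBcont.matrix_det continuous_const).inter
      (isOpen_iInter_of_finite fun i => isOpen_ne_fun (hrad i) continuous_const)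
  · exact (contDiff_const.add L.contDiff).contDiffOn
  · rintro u ⟨_, hu⟩
    exact h.isotropy_eq_of_radius_ne_zero hu hx₀
  · intro u _
    rw [(hder u).fderiv]
    exact L.injective
  · rintro u ⟨hdet, _⟩
    rw [(hder u).fderiv, Submodule.disjoint_def]
    rintro _ ⟨y, rfl⟩ hv
    obtain ⟨ξ, hξ⟩ := h.mem_verticalSpace.1 hv
    change L y = killingField e f w ξ (x₀ + L u) at hξ
    change L y = 0
    obtain ⟨κ, hκ⟩ := hspan ξ
    rw [(h.killingField_eq_sum hx₀ hκ).2] at hξ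
    have hy : L y ∈ (verticalSpace ρ x₀)ᗮ := by
      rw [← hL]
      exact ⟨y, rfl⟩
    have h0 : Matrix.vecMul κ (B u) = 0 := by
      funext b
      have h1 := Submodule.inner_left_of_mem_orthogonal
        (h.killingField_mem_verticalSpace (η b) x₀) hy
      rw [hξ, sum_inner] at h1
      simp only [inner_smul_left, conj_trivial] at h1
      simpa [Matrix.vecMul, dotProduct, B] using h1
    have hκ0 := Matrix.eq_zero_of_vecMul_eq_zero hdet h0
    rw [hξ, hκ0]
    simp
  · rintro u ⟨hdet, _⟩
    rw [(hder u).fderiv, h.fixedSpace_eq_top hx₀, ← Submodule.orthogonal_eq_bot_iff, eq_bot_iff]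
    intro v hv
    rw [← Submodule.inf_orthogonal] at hv
    have hv1 : v ∈ verticalSpace ρ x₀ := by
      rw [← Submodule.orthogonal_orthogonal (verticalSpace ρ x₀), ← hL]
      exact hv.1
    obtain ⟨ξ, hξ⟩ := h.mem_verticalSpace.1 hv1
    change v = killingField e f w ξ x₀ at hξ
    obtain ⟨κ, hκ⟩ := hspan ξ
    rw [hκ] at hξ
    have h0 : (B u).mulVec κ = 0 := by
      funext a
      have h1 := Submodule.inner_right_of_mem_orthogonal
        (h.killingField_mem_verticalSpace (η a) (x₀ + L u)) hv.2
      rw [hξ, inner_sum] at h1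
      simp only [inner_smul_right] at h1
      simpa [Matrix.mulVec, dotProduct, B, mul_comm] using h1
    have hκ0 := Matrix.eq_zero_of_mulVec_eq_zero hdet h0
    rw [hξ, hκ0]
    simp

/-- O'Neill's formula at a point of the principal stratum. -/
theorem curvatureForm_slice (h : IsWeightBasis ρ e f w)
    (hx₀ : ∀ i, radius (e i) (f i) x₀ ≠ 0)
    (hη : ∀ a b, inner ℝ (killingField e f w (η a) x₀) (killingField e f w (η b) x₀) =
      if a = b then (1 : ℝ) else 0)
    (hspan : ∀ ξ, ∃ κ : Fin r → ℝ,
      killingField e f w ξ x₀ = ∑ a, κ a • killingField e f w (η a) x₀)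
    (hL : LinearMap.range L.toLinearMap = (verticalSpace ρ x₀)ᗮ) (x y : Euc d) :
    curvatureForm (quotientMetric ρ fun u => x₀ + L u) 0 x y =
      3 * ∑ a, (inner ℝ (killingField e f w (η a) (L x)) (L y) : ℝ) ^ 2 := by
  let A : Fin r → Euc m →L[ℝ] Euc m := fun a => killingField e f w (η a)
  let M : Euc d → Matrix (Fin r) (Fin r) ℝ := fun u => Matrix.of fun a b =>
    inner ℝ (A a (x₀ + L u)) (A b (x₀ + L u))
  -- The slice is horizontal at x₀, so the inner product of L ∂_i with a Killing field at x₀ + L u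
  -- is purely linear in u, and it is skew because Killing fields are. Hence the metric is the
  -- identity minus a quadratic expression in β weighted by the inverse of the Gram matrix M.
  let β : Fin r → Fin d → Euc d →L[ℝ] ℝ := fun a i =>
    (innerSL ℝ (L (basisVec i))).comp ((A a).comp L.toContinuousLinearMap)
  have hβ_apply : ∀ a i u, β a i u = inner ℝ (L (basisVec i)) (A a (L u)) := fun a i u => rfl
  have hM0 : M 0 = 1 := by
    ext a b
    simp [M, A, hη, Matrix.one_apply]
  have hder : ∀ u, fderiv ℝ (fun u => x₀ + L u) u = L.toContinuousLinearMap := fun u =>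
    (L.toContinuousLinearMap.hasFDerivAt.const_add x₀).fderiv
  have hMc : ∀ a b, ContDiff ℝ ∞ fun u => M u a b := fun a b =>
    ((A a).contDiff.comp (contDiff_const.add L.contDiff)).inner ℝ
      ((A b).contDiff.comp (contDiff_const.add L.contDiff))
  have hMcont : Continuous M := continuous_matrix fun a b => (hMc a b).continuous
  have hhor : ∀ a u, inner ℝ (A a x₀) (L u) = (0 : ℝ) := by
    intro a u
    refine Submodule.inner_right_of_mem_orthogonal (h.killingField_mem_verticalSpace (η a) x₀) ?_
    rw [← hL]
    exact ⟨u, rfl⟩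
  -- The Killing fields indexed by η span the vertical space, so the vertical part of v is computed
  -- with the inverse of their Gram matrix.
  have hproj : ∀ u, (M u).det ≠ 0 → ∀ v, horizontalProj ρ (x₀ + L u) v =
      v - ∑ a, ∑ b, ((M u)⁻¹ b a * inner ℝ (A b (x₀ + L u)) v) • A a (x₀ + L u) := by
    intro u hu v
    refine Submodule.eq_starProjection_of_mem_of_inner_eq_zero
      (K := (verticalSpace ρ (x₀ + L u))ᗮ) ?_ ?_
    · rw [Submodule.mem_orthogonal]
      intro z hz
      obtain ⟨ξ, hξ⟩ := h.mem_verticalSpace.1 hz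
      change z = killingField e f w ξ (x₀ + L u) at hξ
      obtain ⟨κ, hκ⟩ := hspan ξ
      rw [hξ, (h.killingField_eq_sum hx₀ hκ).2, sum_inner]
      refine Finset.sum_eq_zero fun c _ => ?_
      have hc : inner ℝ (A c (x₀ + L u)) (∑ a, ∑ b,
          ((M u)⁻¹ b a * inner ℝ (A b (x₀ + L u)) v) • A a (x₀ + L u)) =
            (inner ℝ (A c (x₀ + L u)) v : ℝ) := by
        calc _ = ∑ a, ∑ b, ((M u)⁻¹ b a * M u a c) * (inner ℝ (A b (x₀ + L u)) v : ℝ) := by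
              simp only [inner_sum, inner_smul_right]
              refine Finset.sum_congr rfl fun a _ => Finset.sum_congr rfl fun b _ => ?_
              have hM : M u a c = inner ℝ (A c (x₀ + L u)) (A a (x₀ + L u)) := by
                simp only [M, Matrix.of_apply]
                rw [real_inner_comm]
              rw [hM]
              ring
          _ = ∑ b, ((M u)⁻¹ * M u) b c * (inner ℝ (A b (x₀ + L u)) v : ℝ) := by
              rw [Finset.sum_comm]
              simp only [Matrix.mul_apply, Finset.sum_mul]
          _ = _ := by
              rw [Matrix.nonsing_inv_mul _ (isUnit_iff_ne_zero.2 hu)]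
              simp [Matrix.one_apply]
      rw [inner_smul_left, inner_sub_right]
      change _ * (inner ℝ (A c (x₀ + L u)) v - _) = 0
      rw [hc, sub_self, mul_zero]
    · intro z hz
      rw [sub_sub_cancel]
      rw [Submodule.mem_orthogonal] at hz
      refine hz _ (Submodule.sum_mem _ fun a _ => Submodule.sum_mem _ fun b _ =>
        Submodule.smul_mem _ _ ?_)
      exact h.killingField_mem_verticalSpace (η a) (x₀ + L u)
  have hmain := curvatureForm_eq_of_skew (g := quotientMetric ρ fun u => x₀ + L u)
    (N := fun a b u => (M u)⁻¹ b a) (β := β)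
    (fun a b => contDiffAt_matrix_inv (fun i j => (hMc i j).contDiffAt) (by simp [hM0]) b a)
    (fun a b => by simp [hM0, Matrix.one_apply, eq_comm])
    (fun a i j => by
      rw [hβ_apply, hβ_apply, real_inner_comm, inner_killingField_left])
    (by
      have hev : ∀ᶠ u in 𝓝 (0 : Euc d), (M u).det ≠ 0 :=
        hMcont.matrix_det.continuousAt.eventually_ne (by simp [hM0])
      filter_upwards [hev] with u hu i j
      have hsymm : inner ℝ (horizontalProj ρ (x₀ + L u) (L (basisVec i)))
          (horizontalProj ρ (x₀ + L u) (L (basisVec j))) =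
            (inner ℝ (L (basisVec i)) (horizontalProj ρ (x₀ + L u) (L (basisVec j))) : ℝ) := by
        unfold horizontalProj
        rw [Submodule.inner_starProjection_left_eq_right,
          Submodule.starProjection_eq_self_iff.2 (Submodule.starProjection_apply_mem _ _)]
      have hbasis : inner ℝ (L (basisVec i)) (L (basisVec j)) = if i = j then (1 : ℝ) else 0 := by
        rw [L.inner_map_map]
        simp [basisVec, EuclideanSpace.inner_single_left]
      rw [quotientMetric, Matrix.of_apply, hder]
      change inner ℝ (horizontalProj ρ (x₀ + L u) (L (basisVec i)))
          (horizontalProj ρ (x₀ + L u) (L (basisVec j))) = _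
      rw [hsymm, hproj u hu, inner_sub_right, hbasis]
      congr 1
      simp only [inner_sum, inner_smul_right, map_add, inner_add_left, inner_add_right, hhor,
        hβ_apply]
      refine Finset.sum_congr rfl fun a _ => Finset.sum_congr rfl fun b _ => ?_
      rw [real_inner_comm (A a x₀) (L (basisVec i)), hhor,
        real_inner_comm (L (basisVec j)) (A b (L u))]
      ring) x y
  rw [hmain]
  congr 1
  refine Finset.sum_congr rfl fun a _ => ?_
  congr 1
  have hx : A a (L x) = ∑ i, x i • A a (L (basisVec i)) := by
    conv_lhs => rw [← sum_smul_basisVec x]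
    simp only [map_sum, map_smul]
  have hy : L y = ∑ j, y j • L (basisVec j) := by
    conv_lhs => rw [← sum_smul_basisVec y]
    simp only [map_sum, map_smul]
  change _ = inner ℝ (A a (L x)) (L y)
  rw [hx, hy, sum_inner]
  refine Finset.sum_congr rfl fun i _ => ?_
  rw [inner_sum]
  refine Finset.sum_congr rfl fun j _ => ?_
  rw [inner_smul_left, inner_smul_right, hβ_apply, real_inner_comm, conj_trivial, mul_assoc]

/-- The metric in slice coordinates is Euclidean at the base point. -/
theorem metricInner_slice
    (hL : LinearMap.range L.toLinearMap = (verticalSpace ρ x₀)ᗮ) (x y : Euc d) :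
    metricInner (quotientMetric ρ fun u => x₀ + L u) 0 x y = inner ℝ (L x) (L y) := by
  have hder : fderiv ℝ (fun u => x₀ + L u) 0 = L.toContinuousLinearMap :=
    (L.toContinuousLinearMap.hasFDerivAt.const_add x₀).fderiv
  have hhor : ∀ z, horizontalProj ρ (x₀ + L 0) (L z) = L z := by
    intro z
    rw [map_zero, add_zero, horizontalProj, Submodule.starProjection_eq_self_iff, ← hL]
    exact ⟨z, rfl⟩
  rw [metricInner_quotientMetric, hder]
  change inner ℝ (horizontalProj ρ (x₀ + L 0) (L x)) (horizontalProj ρ (x₀ + L 0) (L y)) = _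
  rw [hhor, hhor]

end IsWeightBasis

/-! ### Bounded curvature forces independent weights -/

namespace IsWeightBasis

variable {ρ : Torus k →* Orth m} {e f : Fin n → Euc m} {w : Fin n → Fin k → ℤ}

theorem killingField_sum_left (h : IsWeightBasis ρ e f w) (ξ : Fin k → ℝ) (r : ℝ) :
    killingField e f w ξ (r • ∑ j, e j) = r • ∑ j, weightPairing (w j) ξ • f j := by
  have h1 : ∀ i, planeRot (e i) (f i) (∑ j, e j) = f i := by
    intro i
    simp [planeRot_apply, h.inner_right_left, h.inner_left_left]
  rw [map_smul, killingField, rotField_apply]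
  simp only [h1]

theorem killingField_left (h : IsWeightBasis ρ e f w) (ξ : Fin k → ℝ) (i : Fin n) :
    killingField e f w ξ (e i) = weightPairing (w i) ξ • f i := by
  rw [killingField, rotField_apply, Finset.sum_eq_single i]
  · simp [planeRot_apply, h.inner_right_left, h.orthonormal_left.1 i]
  · intro j _ hj
    simp [planeRot_apply, h.inner_right_left, h.inner_left_left, hj]
  · simp

theorem radius_sum_left (h : IsWeightBasis ρ e f w) {r : ℝ} (hr : r ≠ 0) (i : Fin n) :
    radius (e i) (f i) (r • ∑ j, e j) ≠ 0 := by
  intro h0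
  apply hr
  have := (radius_eq_zero_iff.1 h0).1
  simpa [inner_smul_right, inner_sum, h.inner_left_left] using this

/-- A relation between the weights produces large curvature on a part of the orbit space that
contains a point of the principal stratum close to the origin. -/
theorem le_of_stratifiedCurvatureBoundedOn (h : IsWeightBasis ρ e f w) {i : Fin n} {c : Fin n → ℤ}
    (hc : ∀ a, ∑ j, c j * w j a = 0) {ξ : Fin k → ℝ} (hξ : weightPairing (w i) ξ = 1)
    {W : Set (OrbitSpace ρ)} {C : ℝ} (hC : 0 < C) (hW : StratifiedCurvatureBoundedOn ρ W C)
    {r : ℝ} (hr : r ≠ 0) (hmem : orbitMap ρ (r • ∑ j, e j) ∈ W) :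
    3 * (c i : ℝ) ^ 2 ≤
      r ^ 2 * (‖∑ j, weightPairing (w j) ξ • f j‖ ^ 2 * (C * ‖∑ j, (c j : ℝ) • f j‖ ^ 2)) := by
  set x₀ : Euc m := r • ∑ j, e j with hx₀_def
  set b : Euc m := ∑ j, (c j : ℝ) • f j with hb
  have hx₀ : ∀ i, radius (e i) (f i) x₀ ≠ 0 := h.radius_sum_left hr
  let t := stdOrthonormalBasis ℝ (verticalSpace ρ x₀)
  let q := stdOrthonormalBasis ℝ ((verticalSpace ρ x₀)ᗮ : Submodule ℝ (Euc m))
  -- Lie algebra elements whose Killing fields form an orthonormal basis of the vertical space at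
  -- x₀.
  choose η hη using fun a => h.mem_verticalSpace.1 (t a).2
  have hη' : ∀ a, killingField e f w (η a) x₀ = t a := fun a => (hη a).symm
  have hon : ∀ a b, inner ℝ (killingField e f w (η a) x₀) (killingField e f w (η b) x₀) =
      if a = b then (1 : ℝ) else 0 := by
    intro a b
    rw [hη', hη', ← Submodule.coe_inner]
    exact orthonormal_iff_ite.1 t.orthonormal a b
  have hspan : ∀ ζ, killingField e f w ζ x₀ =
      ∑ a, (inner ℝ (t a : Euc m) (killingField e f w ζ x₀) : ℝ) •
        killingField e f w (η a) x₀ := by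
    intro ζ
    have h1 := t.sum_repr' ⟨_, h.killingField_mem_verticalSpace ζ x₀⟩
    have h2 := congrArg Subtype.val h1
    simp only [Submodule.coe_sum, Submodule.coe_smul, Submodule.coe_inner] at h2
    simp only [hη']
    exact h2.symm
  let L := (verticalSpace ρ x₀)ᗮ.subtypeₗᵢ.comp q.repr.symm.toLinearIsometry
  have hLq : ∀ v : (verticalSpace ρ x₀)ᗮ, L (q.repr v) = v := by
    intro v
    simp [L]
  have hL : LinearMap.range L.toLinearMap = (verticalSpace ρ x₀)ᗮ := by
    ext v
    constructor
    · rintro ⟨u, rfl⟩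
      exact (q.repr.symm u).2
    · intro hv
      exact ⟨q.repr ⟨v, hv⟩, hLq ⟨v, hv⟩⟩
  have hei : e i ∈ (verticalSpace ρ x₀)ᗮ := by
    rw [Submodule.mem_orthogonal]
    intro z hz
    obtain ⟨ζ, hζ⟩ := h.mem_verticalSpace.1 hz
    change z = killingField e f w ζ x₀ at hζ
    rw [hζ, hx₀_def, h.killingField_sum_left]
    simp [inner_smul_left, sum_inner, h.inner_right_left]
  have hfb : ∀ j, inner ℝ (f j) b = (c j : ℝ) := by
    intro j
    simp [hb, inner_sum, inner_smul_right, h.inner_right_right]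
  -- The inner product of b with a Killing field at x₀ is r times the weight relation evaluated on
  -- its Lie algebra element, hence zero.
  have hbmem : b ∈ (verticalSpace ρ x₀)ᗮ := by
    rw [Submodule.mem_orthogonal]
    intro z hz
    obtain ⟨ζ, hζ⟩ := h.mem_verticalSpace.1 hz
    change z = killingField e f w ζ x₀ at hζ
    rw [hζ, hx₀_def, h.killingField_sum_left, inner_smul_left, sum_inner]
    simp only [inner_smul_left, hfb, conj_trivial, weightPairing, Finset.sum_mul]
    rw [Finset.sum_comm]
    have h0 : ∀ a, ∑ j, (w j a : ℝ) * ζ a * c j = 0 := by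
      intro a
      have h1 : ∑ j, (c j : ℝ) * w j a = 0 := by exact_mod_cast hc a
      calc _ = ζ a * ∑ j, (c j : ℝ) * w j a := by
            rw [Finset.mul_sum]
            exact Finset.sum_congr rfl fun j _ => by ring
        _ = 0 := by rw [h1, mul_zero]
    simp [h0]
  obtain ⟨U, hU, hcoord⟩ := h.exists_isLocalCoordinates hx₀ hon (fun ζ => ⟨_, hspan ζ⟩) hL
  have hbound := hW _ _ U _ hcoord 0 hU (by simpa using hmem) (q.repr ⟨e i, hei⟩) (q.repr ⟨b, hbmem⟩)
  rw [h.curvatureForm_slice hx₀ hon (fun ζ => ⟨_, hspan ζ⟩) hL, metricInner_slice hL,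
    metricInner_slice hL, metricInner_slice hL, hLq, hLq] at hbound
  have hterm : ∀ a, inner ℝ (killingField e f w (η a) (e i)) b =
      weightPairing (w i) (η a) * (c i : ℝ) := by
    intro a
    rw [h.killingField_left, inner_smul_left, hfb]
    rfl
  simp only [hterm, real_inner_self_eq_norm_sq, h.orthonormal_left.1 i, mul_pow] at hbound
  rw [← Finset.sum_mul] at hbound
  set S : ℝ := ∑ a, weightPairing (w i) (η a) ^ 2 with hS
  have hS0 : 0 ≤ S := Finset.sum_nonneg fun a _ => sq_nonneg _
  have h1 : 3 * (S * (c i : ℝ) ^ 2) ≤ C * ‖b‖ ^ 2 := by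
    refine (le_abs_self _).trans (hbound.trans ?_)
    refine mul_le_mul_of_nonneg_left ?_ hC.le
    have := sq_nonneg (inner ℝ (e i) b : ℝ)
    linarith
  -- Expand the Killing field of ξ at x₀ in the orthonormal basis with coefficients κ_a. Then 1 =
  -- w_i(ξ) = ∑ κ_a w_i(η a), and the sum of the κ_a² is the squared length of that field, of order
  -- r². Cauchy–Schwarz bounds S below by order 1/r².
  have h2 : 1 ≤ r ^ 2 * ‖∑ j, weightPairing (w j) ξ • f j‖ ^ 2 * S := by
    have h3 := (h.killingField_eq_sum hx₀ (hspan ξ)).1 i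
    rw [hξ] at h3
    have h4 := Finset.sum_mul_sq_le_sq_mul_sq Finset.univ
      (fun a => (inner ℝ (t a : Euc m) (killingField e f w ξ x₀) : ℝ))
      (fun a => weightPairing (w i) (η a))
    rw [← h3, one_pow] at h4
    have h5 : ∑ a, (inner ℝ (t a : Euc m) (killingField e f w ξ x₀) : ℝ) ^ 2 =
        r ^ 2 * ‖∑ j, weightPairing (w j) ξ • f j‖ ^ 2 := by
      have h6 := t.sum_sq_norm_inner_right ⟨_, h.killingField_mem_verticalSpace ξ x₀⟩
      simp only [Submodule.coe_inner, Submodule.coe_norm, Real.norm_eq_abs, sq_abs] at h6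
      rw [h6, hx₀_def, h.killingField_sum_left, norm_smul, mul_pow, Real.norm_eq_abs, sq_abs]
    rwa [h5] at h4
  calc 3 * (c i : ℝ) ^ 2 = 1 * (3 * (c i : ℝ) ^ 2) := (one_mul _).symm
    _ ≤ (r ^ 2 * ‖∑ j, weightPairing (w j) ξ • f j‖ ^ 2 * S) * (3 * (c i : ℝ) ^ 2) :=
      mul_le_mul_of_nonneg_right h2 (by positivity)
    _ = r ^ 2 * ‖∑ j, weightPairing (w j) ξ • f j‖ ^ 2 * (3 * (S * (c i : ℝ) ^ 2)) := by ring
    _ ≤ r ^ 2 * ‖∑ j, weightPairing (w j) ξ • f j‖ ^ 2 * (C * ‖b‖ ^ 2) :=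
      mul_le_mul_of_nonneg_left h1 (by positivity)
    _ = _ := by ring

/-- Boundedness is needed only at the orbit of the origin: along the ray r ∑ e_j a relation would
force 3 c_i² ≤ r² K with K independent of r, which fails as r → 0. -/
theorem hasDualCoweights_of_hasBoundedStratifiedCurvature (h : IsWeightBasis ρ e f w)
    (hb : HasBoundedStratifiedCurvature ρ) : HasDualCoweights w := by
  by_contra hD
  obtain ⟨i, c, hci, hc⟩ := exists_relation_of_not_hasDualCoweights hD
  obtain ⟨C, hC, W, hW, hbound⟩ := hb (orbitMap ρ 0)
  obtain ⟨ξ, hξ⟩ := h.exists_weightPairing_eq i 1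
  have hcont : Continuous fun r : ℝ => orbitMap ρ (r • ∑ j, e j) :=
    continuous_quotient_mk'.comp (continuous_id.smul continuous_const)
  have hev : ∀ᶠ r : ℝ in 𝓝[≠] 0, orbitMap ρ (r • ∑ j, e j) ∈ W := by
    have h1 : Filter.Tendsto (fun r : ℝ => orbitMap ρ (r • ∑ j, e j)) (𝓝 0)
        (𝓝 (orbitMap ρ 0)) := by
      simpa using hcont.tendsto 0
    exact (h1.mono_left nhdsWithin_le_nhds) hW
  set K : ℝ := ‖∑ j, weightPairing (w j) ξ • f j‖ ^ 2 * (C * ‖∑ j, (c j : ℝ) • f j‖ ^ 2)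
  have hle : ∀ᶠ r : ℝ in 𝓝[≠] 0, 3 * (c i : ℝ) ^ 2 ≤ r ^ 2 * K := by
    filter_upwards [hev, self_mem_nhdsWithin] with r hr hr0
    exact h.le_of_stratifiedCurvatureBoundedOn hc hξ hC hbound hr0 hr
  have hlim : Filter.Tendsto (fun r : ℝ => r ^ 2 * K) (𝓝[≠] 0) (𝓝 0) := by
    have : Continuous fun r : ℝ => r ^ 2 * K := by fun_prop
    have h2 := this.tendsto 0
    simp only [ne_eq, OfNat.ofNat_ne_zero, not_false_eq_true, zero_pow, zero_mul] at h2
    exact h2.mono_left nhdsWithin_le_nhds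
  have h0 := ge_of_tendsto hlim hle
  have hpos : 0 < (c i : ℝ) ^ 2 := by
    have : (c i : ℝ) ≠ 0 := by exact_mod_cast hci
    positivity
  linarith

end IsWeightBasis

theorem HasUniformlyBoundedStratifiedCurvature.hasBoundedStratifiedCurvature
    {ρ : Torus k →* Orth m} (h : HasUniformlyBoundedStratifiedCurvature ρ) :
    HasBoundedStratifiedCurvature ρ := by
  obtain ⟨C, hC, hb⟩ := h
  exact fun p => ⟨C, hC, Set.univ, Filter.univ_mem, hb⟩

end ToricQuotient

end

theorem lemma4p1 (k m : ℕ)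
    (ρ : ToricQuotient.Torus k →* ToricQuotient.Orth m)
    (hρ : ∀ x : ToricQuotient.Euc m, Continuous fun t : ToricQuotient.Torus k => ρ t x) :
    (ToricQuotient.HasBoundedStratifiedCurvature ρ ↔ ToricQuotient.IsSplit ρ) ∧
      (ToricQuotient.HasUniformlyBoundedStratifiedCurvature ρ ↔ ToricQuotient.IsSplit ρ) := by
  obtain ⟨n, e, f, w, h⟩ := ToricQuotient.exists_isWeightBasis ρ hρ
  have hbs : ToricQuotient.HasBoundedStratifiedCurvature ρ → ToricQuotient.IsSplit ρ := fun hb =>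
    h.isSplit_of_hasDualCoweights (h.hasDualCoweights_of_hasBoundedStratifiedCurvature hb)
  have hsu : ToricQuotient.IsSplit ρ → ToricQuotient.HasUniformlyBoundedStratifiedCurvature ρ :=
    fun hs => h.hasUniformlyBoundedStratifiedCurvature (h.hasDualCoweights_of_isSplit hs)
  exact ⟨⟨hbs, fun hs => (hsu hs).hasBoundedStratifiedCurvature⟩,
    ⟨fun hu => hbs hu.hasBoundedStratifiedCurvature, hsu⟩⟩
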